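/- Let $\mathcal X\subset\mathbb R^n$ be compact and consider binary classification with label set $\mathcal C=\{0,1\}$. A domain $\mathcal D=(\mu_{\mathcal D},l_{\mathcal D})$ consists of a Borel probability measure $\mu_{\mathcal D}$ on $\mathcal X$ and a measurable labeling function $l_{\mathcal D}:\mathcal X\to\mathcal C$; the error of a hypothesis $h:\mathcal X\to\mathcal C$ on $\mathcal D$ is $\epsilon_{\mathcal D}(h)=\Pr_{x\sim\mu_{\mathcal D}}[h(x)\ne l_{\mathcal D}(x)]$. For domains $\mathcal D,\mathcal D'$ and $k\ge 1$ the $k$-th order label-wise moment divergence is $$d_{LM,k}(\mathcal D,\mathcal D')=\sum_{c\in\mathcal C}\ \sum_{\mathbf i\in\mathbb N_0^n,\ i_1+\dots+i_n=k}\Bigl|\,p(c)\int_{\mathcal X}\prod_{j=1}^n x_j^{i_j}\,d\mu_c(x)-p'(c)\int_{\mathcal X}\prod_{j=1}^n x_j^{i_j}\,d\mu'_c(x)\Bigr|,$$ where $p(c)=\mu_{\mathcal D}(l_{\mathcal D}=c)$, $\mu_c=\mu_{\mathcal D}(\,\cdot\mid l_{\mathcal D}=c)$, and $p'(c),\mu'_c$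 are the same objects for $\mathcal D'$ (a term with $p(c)=0$ or $p'(c)=0$ is read as $0$). Let $\mathcal S_1,\dots,\mathcal S_N$ (sources) and $\mathcal T$ (target) be domains over $\mathcal X$, and let $\mathcal H$ be a class of measurable hypotheses $\mathcal X\to\{0,1\}$ of finite VC dimension $d$ which satisfies the usual measurability convention that for all $k$ and all $b\in\{0,1\}^k$ the set of $(x_1,\dots,x_k)\in\mathcal X^k$ for which some $h\in\mathcal H$ has $h(x_j)=b_j$ for all $j$ is universally measurable. Let $\alpha_1,\dots,\alpha_N\ge 0$ with $\sum_i\alpha_i=1$. Let $n_{\mathcal S_1},\dots,n_{\mathcal S_N}\ge1$ be integers, $m=\sum_i n_{\mathcal S_i}$ with $d\le 2m$, and $\beta_i=n_{\mathcal S_i}/m$. Draw independent points $x^{\mathcal S_i}_j\sim\mu_{\mathcal S_i}$ ($1\le i\le N$, $1\le j\le n_{\mathcal S_i}$), with labels $y^{\mathcal S_i}_j=l_{\mathcal S_i}(x^{\mathcal S_i}_j)$, and put $$\hat\epsilon_{\alpha}(h)=\sum_{i=1}^N\alpha_i\,\frac1{n_{\mathcal S_i}}\sum_{j=1}^{n_{\mathcal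 S_i}}\mathbf 1_{h(x^{\mathcal S_i}_j)\ne y^{\mathcal S_i}_j}.$$ Let $h^*_{\mathcal T}\in\mathcal H$ minimize $\epsilon_{\mathcal T}$ over $\mathcal H$, let $\lambda_i=\inf_{h\in\mathcal H}\{\epsilon_{\mathcal T}(h)+\epsilon_{\mathcal S_i}(h)\}$, and let $$\eta_{\alpha,\beta,m,\delta}=4\sqrt{\Bigl(\sum_{i=1}^N\frac{\alpha_i^2}{\beta_i}\Bigr)\,\frac{2d\bigl(\log\frac{2m}{d}+1\bigr)+2\log\frac4\delta}{m}}$$ (for $d=0$ the term $2d(\log\frac{2m}{d}+1)$ is read as $0$). Then for every $\delta\in(0,1)$ and $\epsilon>0$ there exist nonnegative integers $n_\epsilon^1,\dots,n_\epsilon^N$ and real constants $a_{n_\epsilon^1},\dots,a_{n_\epsilon^N}$, not depending on the drawn sample, such that with probability at least $1-\delta$ over the sample every $\hat h\in\mathcal H$ that minimizes $\hat\epsilon_\alpha$ over $\mathcal H$ satisfies $$\epsilon_{\mathcal T}(\hat h)\le\epsilon_{\mathcal T}(h^*_{\mathcal T})+\eta_{\alpha,\beta,m,\delta}+\epsilon+\sum_{i=1}^N\alpha_i\Bigl(2\lambda_i+a_{n_\epsilon^i}\sum_{k=1}^{n_\epsilon^i}d_{LM,k}(\mathcal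 S_i,\mathcal T)\Bigr).$$ -/

import Mathlib

open MeasureTheory ProbabilityTheory

noncomputable section

/-- A domain over an input space `𝒳`: a data distribution together with a (binary) labeling
function. -/
structure LabeledDomain (𝒳 : Type*) [MeasurableSpace 𝒳] where
  /-- the data distribution -/
  μ : Measure 𝒳
  isProb : IsProbabilityMeasure μ
  /-- the labeling function -/
  label : 𝒳 → Bool
  measurable_label : Measurable label

namespace LabeledDomain

variable {𝒳 : Type*} [MeasurableSpace 𝒳]

/-- The error rate `Pr_{x ∼ μ} [h x ≠ label x]` of a hypothesis on a domain. -/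
def error (D : LabeledDomain 𝒳) (h : 𝒳 → Bool) : ℝ :=
  D.μ.real {x | h x ≠ D.label x}

/-- The probability `p(c)` that a data point of the domain has label `c`. -/
def labelProb (D : LabeledDomain 𝒳) (c : Bool) : ℝ :=
  D.μ.real {x | D.label x = c}

/-- The data distribution `μ_c` of the domain given that the label is `c`. -/
def condLabel (D : LabeledDomain 𝒳) (c : Bool) : Measure 𝒳 :=
  ProbabilityTheory.cond D.μ {x | D.label x = c}

end LabeledDomain

/-- The `k`-th order label-wise moment divergence of two domains over `X ⊆ ℝⁿ`. The multi-indices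
`e : Fin n → ℕ` with `∑ j, e j = k` form `Finset.piAntidiag Finset.univ k`. -/
def labelMomentDiv {n : ℕ} {X : Set (Fin n → ℝ)} (k : ℕ) (D D' : LabeledDomain X) : ℝ :=
  ∑ c : Bool, ∑ e ∈ Finset.piAntidiag (Finset.univ : Finset (Fin n)) k,
    |D.labelProb c * ∫ x : X, ∏ j, (x : Fin n → ℝ) j ^ e j ∂(D.condLabel c) -
      D'.labelProb c * ∫ x : X, ∏ j, (x : Fin n → ℝ) j ^ e j ∂(D'.condLabel c)|

/-- `H` shatters the finite set `A`: every labeling of `A` is realized by a member of `H`. -/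
def ClassShatters {𝒳 : Type*} (H : Set (𝒳 → Bool)) (A : Finset 𝒳) : Prop :=
  ∀ b : 𝒳 → Bool, ∃ h ∈ H, ∀ x ∈ A, h x = b x

/-- The VC dimension: the supremum of the cardinalities of the finite sets shattered by `H`. -/
def classVCDim {𝒳 : Type*} (H : Set (𝒳 → Bool)) : ℕ∞ :=
  ⨆ (A : Finset 𝒳) (_ : ClassShatters H A), (A.card : ℕ∞)

/-- The measurability convention on a hypothesis class that makes uniform deviations over the
(possibly uncountable) class measurable: every hypothesis is measurable and, for every labeling
pattern `b` of length `k`, the set of `k`-tuples of points on which some hypothesis realizes `b` is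
universally measurable. Every countable class of measurable hypotheses has this property. -/
structure IsMeasurableClass {𝒳 : Type*} [MeasurableSpace 𝒳] (H : Set (𝒳 → Bool)) : Prop where
  measurable : ∀ h ∈ H, Measurable h
  trace : ∀ (k : ℕ) (b : Fin k → Bool) (ν : Measure (Fin k → 𝒳)), IsProbabilityMeasure ν →
    NullMeasurableSet {x : Fin k → 𝒳 | ∃ h ∈ H, ∀ j, h (x j) = b j} ν

section Samples

variable {𝒳 : Type*} [MeasurableSpace 𝒳] {N : ℕ}

/-- The input points of `N` datasets, the `i`-th one of size `nS i`. The point `s ⟨i, j⟩` has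
the label `(S i).label (s ⟨i, j⟩)`. -/
abbrev SourceSample (𝒳 : Type*) {N : ℕ} (nS : Fin N → ℕ) : Type _ :=
  ((i : Fin N) × Fin (nS i)) → 𝒳

/-- The law of the datasets: all points are independent and those of the `i`-th dataset are drawn
from the data distribution of the `i`-th source domain. -/
def sampleLaw (S : Fin N → LabeledDomain 𝒳) (nS : Fin N → ℕ) : Measure (SourceSample 𝒳 nS) :=
  haveI := fun i => (S i).isProb
  Measure.pi fun q : (i : Fin N) × Fin (nS i) => (S q.1).μ

/-- The empirical error of `h` on the `i`-th dataset. -/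
def empError (S : Fin N → LabeledDomain 𝒳) (nS : Fin N → ℕ) (s : SourceSample 𝒳 nS) (i : Fin N)
    (h : 𝒳 → Bool) : ℝ :=
  1 / (nS i : ℝ) * ∑ j : Fin (nS i), if h (s ⟨i, j⟩) ≠ (S i).label (s ⟨i, j⟩) then (1 : ℝ) else 0

/-- The `α`-weighted empirical source error. -/
def weightedEmpError (S : Fin N → LabeledDomain 𝒳) (nS : Fin N → ℕ) (α : Fin N → ℝ)
    (s : SourceSample 𝒳 nS) (h : 𝒳 → Bool) : ℝ :=
  ∑ i, α i * empError S nS s i h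

/-- `h` minimizes the `α`-weighted empirical source error over `H`. -/
def IsEmpMinimizer (S : Fin N → LabeledDomain 𝒳) (nS : Fin N → ℕ) (α : Fin N → ℝ)
    (H : Set (𝒳 → Bool)) (s : SourceSample 𝒳 nS) (h : 𝒳 → Bool) : Prop :=
  h ∈ H ∧ ∀ h' ∈ H, weightedEmpError S nS α s h ≤ weightedEmpError S nS α s h'

end Samples

/-- The best joint error `λ` of a source domain and a target domain over the class `H`. -/
def jointError {𝒳 : Type*} [MeasurableSpace 𝒳] (H : Set (𝒳 → Bool)) (S T : LabeledDomain 𝒳) : ℝ :=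
  ⨅ h : H, (T.error h + S.error h)

/-- The deviation term `η_{α,β,m,δ}` for a class of VC dimension `d`. -/
def deviationTerm {N : ℕ} (d : ℕ) (α β : Fin N → ℝ) (m : ℕ) (δ : ℝ) : ℝ :=
  4 * Real.sqrt ((∑ i, α i ^ 2 / β i) *
    ((2 * d * (Real.log (2 * m / d) + 1) + 2 * Real.log (4 / δ)) / m))

end

/-! The proof joins a statistical bound and a comparison of domains through the minimizing property
of `hhat`. Uniformly over `H`, the `α`-weighted source error exceeds its empirical version by at
most η/2; for the fixed hypothesis `hT`, Hoeffding's inequality bounds the opposite deviation by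
η/2. So only one direction has to be uniform. Exchanging source errors for target errors happens
twice, for `hhat` and for `hT`, whence the factor 2 before λ_i.

The uniform deviation (`measure_exists_weightedRisk_sub_weightedLoss_gt_le`) is Vapnik–Chervonenkis
symmetrization. Swapping a point with its independent copy preserves the law of the double sample
even when the points are not identically distributed. For a fixed double sample, Sauer–Shelah leaves
few traces of `H`, and each gives a sum of random signs with a Gaussian tail. The weights enter only
through ∑ w² = ∑ α_i²/n_i.

For the comparison (`exists_abs_error_sub_error_le`), the error of `h` is the sum over labels c of
the mass of {label = c, h ≠ c}, so a difference of errors is a sum of functionals `labelDiff`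
applied to indicators of {h ≠ c}. The moment divergences control `labelDiff` on monomials of
positive degree, hence on polynomials without constant term, which are L¹-dense among the functions
vanishing at the origin. Finite VC dimension makes `H` totally bounded in L¹, so one degree and one
constant serve all hypotheses.

The origin remains, because moments of order zero are absent. If the two labels agree there, a
hypothesis errs on both domains or on neither, and only the masses of the origin matter; these are
complementary to the masses away from it, which the moments control. If the labels differ, every
hypothesis errs there on one domain, so the smaller mass is at most λ. -/

/-! ### Traces of a class on finitely many points -/

/-- The set of indices of the points `x j` to which the hypothesis `h` gives the label `true`. -/
def trueIndices {𝒳 κ : Type*} [Fintype κ] (x : κ → 𝒳) (h : 𝒳 → Bool) : Finset κ :=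
  Finset.univ.filter fun j => h (x j) = true

lemma mem_trueIndices {𝒳 κ : Type*} [Fintype κ] {x : κ → 𝒳} {h : 𝒳 → Bool} {j : κ} :
    j ∈ trueIndices x h ↔ h (x j) = true := by
  simp [trueIndices]

lemma trueIndices_eq_iff {𝒳 κ : Type*} [Fintype κ] {x : κ → 𝒳} {h h' : 𝒳 → Bool} :
    trueIndices x h = trueIndices x h' ↔ ∀ j, h (x j) = h' (x j) := by
  simp only [Finset.ext_iff, mem_trueIndices]
  exact forall_congr' fun j => by cases h (x j) <;> cases h' (x j) <;> simp

open Classical in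
/-- The trace of the class `H` on the points `x j`, as a family of subsets of the index type. -/
noncomputable def traceFamily {𝒳 κ : Type*} [Fintype κ] (H : Set (𝒳 → Bool)) (x : κ → 𝒳) :
    Finset (Finset κ) :=
  Finset.univ.filter fun A => ∃ h ∈ H, trueIndices x h = A

lemma mem_traceFamily {𝒳 κ : Type*} [Fintype κ] {H : Set (𝒳 → Bool)} {x : κ → 𝒳}
    {A : Finset κ} : A ∈ traceFamily H x ↔ ∃ h ∈ H, trueIndices x h = A := by
  simp [traceFamily]

lemma ClassShatters.card_le {𝒳 : Type*} {H : Set (𝒳 → Bool)} {d : ℕ}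
    (hd : classVCDim H ≤ d) {A : Finset 𝒳} (hA : ClassShatters H A) : A.card ≤ d := by
  have h : (A.card : ℕ∞) ≤ classVCDim H := le_iSup₂_of_le A hA le_rfl
  exact_mod_cast h.trans hd

/-- A set of indices shattered by the trace of `H` corresponds to a set of distinct points
shattered by `H`. -/
lemma card_le_of_shatters_traceFamily {𝒳 κ : Type*} [Fintype κ] [DecidableEq κ]
    {H : Set (𝒳 → Bool)} {d : ℕ} (hd : classVCDim H ≤ d) (x : κ → 𝒳) {A : Finset κ}
    (hA : (traceFamily H x).Shatters A) : A.card ≤ d := by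
  classical
  have key : ∀ B ⊆ A, ∃ h ∈ H, ∀ j ∈ A, h (x j) = true ↔ j ∈ B := by
    intro B hB
    obtain ⟨u, hu, huB⟩ := hA hB
    obtain ⟨h, hh, rfl⟩ := mem_traceFamily.1 hu
    refine ⟨h, hh, fun j hj => ?_⟩
    rw [← huB, Finset.mem_inter, mem_trueIndices]
    simp [hj]
  -- Equal points receive equal labels, so a repeated point cannot have its two indices separated.
  have hinj : Set.InjOn x A := by
    intro i hi j hj hij
    by_contra hne
    obtain ⟨h, -, hh⟩ := key {i} (by simpa using hi)
    have h1 := (hh i hi).2 (by simp)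
    have h2 := (hh j hj).1 (hij ▸ h1)
    exact hne (Finset.mem_singleton.1 h2).symm
  rw [← Finset.card_image_of_injOn hinj]
  refine ClassShatters.card_le hd fun b => ?_
  obtain ⟨h, hh, hhb⟩ := key (A.filter fun j => b (x j) = true) (Finset.filter_subset _ _)
  refine ⟨h, hh, fun y hy => ?_⟩
  obtain ⟨j, hj, rfl⟩ := Finset.mem_image.1 hy
  have := hhb j hj
  rw [Finset.mem_filter] at this
  rw [Bool.eq_iff_iff, this]
  simp [hj]

/-- **Sauer–Shelah lemma** for the trace of a class of VC dimension at most `d`. -/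
theorem card_traceFamily_le {𝒳 κ : Type*} [Fintype κ] {H : Set (𝒳 → Bool)} {d : ℕ}
    (hd : classVCDim H ≤ d) (x : κ → 𝒳) :
    (traceFamily H x).card ≤ ∑ k ∈ Finset.range (d + 1), (Fintype.card κ).choose k := by
  classical
  refine (Finset.card_le_card_shatterer _).trans (Finset.card_shatterer_le_sum_vcDim.trans ?_)
  refine Finset.sum_le_sum_of_subset fun k hk => ?_
  have : (traceFamily H x).vcDim ≤ d :=
    Finset.sup_le fun A hA => card_le_of_shatters_traceFamily hd x (Finset.mem_shatterer.1 hA)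
  rw [Finset.mem_Iic] at hk
  exact Finset.mem_range.2 (by omega)

/-- Weighting the `k`-th term by (M/d)^(d-k) ≥ 1 completes the partial sum to a binomial expansion,
and (1 + d/M)^M ≤ e^d. This growth function gives the logarithm in the deviation term. -/
lemma sum_range_choose_le_exp {M d : ℕ} (h : d ≤ M) :
    ((∑ k ∈ Finset.range (d + 1), M.choose k : ℕ) : ℝ) ≤
      Real.exp (d * (Real.log (M / d) + 1)) := by
  rcases Nat.eq_zero_or_pos d with rfl | hd
  · simp
  have hd' : (0 : ℝ) < d := by exact_mod_cast hd
  have hM : (0 : ℝ) < M := by exact_mod_cast hd.trans_le h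
  have hdM : (1 : ℝ) ≤ M / d := by rw [one_le_div hd']; exact_mod_cast h
  calc ((∑ k ∈ Finset.range (d + 1), M.choose k : ℕ) : ℝ)
      = ∑ k ∈ Finset.range (d + 1), (M.choose k : ℝ) := by push_cast; rfl
    _ ≤ ∑ k ∈ Finset.range (d + 1), (M / d : ℝ) ^ d * ((d / M : ℝ) ^ k * M.choose k) := by
        refine Finset.sum_le_sum fun k hk => ?_
        have hk' : k ≤ d := Nat.lt_succ_iff.1 (Finset.mem_range.1 hk)
        have : (1 : ℝ) ≤ (M / d : ℝ) ^ d * (d / M : ℝ) ^ k := by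
          have e : (M / d : ℝ) ^ d * (d / M : ℝ) ^ k = (M / d : ℝ) ^ (d - k) := by
            rw [← Nat.sub_add_cancel hk', pow_add, mul_assoc, ← mul_pow,
              Nat.sub_add_cancel hk']
            have : (M / d : ℝ) * (d / M) = 1 := by field_simp
            rw [this]; simp
          rw [e]; exact one_le_pow₀ hdM
        calc (M.choose k : ℝ) = 1 * M.choose k := (one_mul _).symm
          _ ≤ _ := by rw [← mul_assoc]; gcongr
    _ ≤ (M / d : ℝ) ^ d * ∑ k ∈ Finset.range (M + 1), (d / M : ℝ) ^ k * M.choose k := by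
        rw [← Finset.mul_sum]
        gcongr
    _ = (M / d : ℝ) ^ d * (d / M + 1 : ℝ) ^ M := by rw [add_pow]; simp
    _ ≤ (M / d : ℝ) ^ d * (Real.exp (d / M)) ^ M := by gcongr; exact Real.add_one_le_exp _
    _ = Real.exp (d * (Real.log (M / d) + 1)) := by
        rw [mul_add, Real.exp_add, ← Real.exp_nat_mul, ← Real.exp_log (zero_lt_one.trans_le hdM),
          ← Real.exp_nat_mul, Real.log_exp]
        congr 2
        field_simp

/-- Termwise comparison with the binomial expansion. Polynomial growth is all that the total
boundedness argument needs, and no relation between `d` and `M` is required. -/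
lemma sum_range_choose_le_pow (M d : ℕ) :
    ∑ k ∈ Finset.range (d + 1), M.choose k ≤ (M + 1) ^ d := by
  rw [add_pow]
  refine Finset.sum_le_sum fun k hk => ?_
  have hkd : k ≤ d := Nat.lt_succ_iff.1 (Finset.mem_range.1 hk)
  calc M.choose k ≤ M ^ k := Nat.choose_le_pow M k
    _ ≤ _ := by
      rw [one_pow, mul_one]
      exact Nat.le_mul_of_pos_right _ (Nat.choose_pos hkd)

/-! ### Counting signs -/

/-- The unnormalized moment generating function of a Rademacher sum; it factors over coordinates. -/
lemma sum_exp_signed_sum {ι : Type*} [Fintype ι] [DecidableEq ι] (c : ι → ℝ) :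
    ∑ σ : ι → Bool, Real.exp (∑ q, if σ q then -c q else c q) = ∏ q, (2 * Real.cosh (c q)) := by
  simp_rw [Real.exp_sum]
  rw [← Fintype.prod_sum (fun q (b : Bool) => Real.exp (if b then -c q else c q))]
  refine Finset.prod_congr rfl fun q _ => ?_
  rw [Real.cosh_eq]
  simp
  ring

/-- The proportion of the choices of signs for which the signed sum of the numbers `c q` exceeds
`u` decays like a Gaussian tail. -/
lemma card_signed_sum_gt_le {ι : Type*} [Fintype ι] [DecidableEq ι] (c : ι → ℝ) {u W : ℝ}
    (hu : 0 ≤ u) (hW : 0 < W) (hc : ∑ q, c q ^ 2 ≤ W) :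
    (((Finset.univ : Finset (ι → Bool)).filter
        fun σ => u < ∑ q, if σ q then -c q else c q).card : ℝ) ≤
      2 ^ Fintype.card ι * Real.exp (-u ^ 2 / (2 * W)) := by
  -- The minimizer of the Chernoff exponent r²W/2 - ru.
  set r : ℝ := u / W
  have hr : 0 ≤ r := by positivity
  set F := (Finset.univ : Finset (ι → Bool)).filter fun σ => u < ∑ q, if σ q then -c q else c q
  have h1 : (F.card : ℝ) * Real.exp (r * u) ≤ 2 ^ Fintype.card ι * Real.exp (r ^ 2 * W / 2) := by
    calc (F.card : ℝ) * Real.exp (r * u)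
        = ∑ σ ∈ F, Real.exp (r * u) := by simp
      _ ≤ ∑ σ ∈ F, Real.exp (∑ q, if σ q then -(r * c q) else r * c q) := by
          refine Finset.sum_le_sum fun σ hσ => Real.exp_le_exp.2 ?_
          have h := (Finset.mem_filter.1 hσ).2
          calc r * u ≤ r * ∑ q, (if σ q then -c q else c q) := by gcongr
            _ = _ := by
              rw [Finset.mul_sum]
              exact Finset.sum_congr rfl fun q _ => by split_ifs <;> ring
      _ ≤ ∑ σ : ι → Bool, Real.exp (∑ q, if σ q then -(r * c q) else r * c q) :=
          Finset.sum_le_sum_of_subset_of_nonneg (Finset.subset_univ _) fun _ _ _ => by positivity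
      _ = ∏ q, (2 * Real.cosh (r * c q)) := sum_exp_signed_sum _
      _ ≤ ∏ q, (2 * Real.exp ((r * c q) ^ 2 / 2)) :=
          Finset.prod_le_prod (fun q _ => by positivity)
            fun q _ => by gcongr; exact Real.cosh_le_exp_half_sq _
      _ = 2 ^ Fintype.card ι * Real.exp (r ^ 2 * (∑ q, c q ^ 2) / 2) := by
          rw [Finset.prod_mul_distrib, ← Real.exp_sum, Finset.prod_const, Finset.card_univ]
          congr 2
          rw [Finset.mul_sum, Finset.sum_div]
          exact Finset.sum_congr rfl fun q _ => by ring
      _ ≤ _ := by gcongr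
  have h2 : -u ^ 2 / (2 * W) = r ^ 2 * W / 2 - r * u := by
    simp only [r]; field_simp; ring
  rw [h2, Real.exp_sub, ← mul_div_assoc, le_div_iff₀ (Real.exp_pos _)]
  exact h1

/-! ### Uniform deviations of weighted losses -/

section Deviation

variable {𝒳 ι : Type*}

/-- The zero-one loss of the hypothesis `h` with respect to the labeling function `l`. -/
def zeroOneLoss (l h : 𝒳 → Bool) (x : 𝒳) : ℝ := if h x ≠ l x then 1 else 0

lemma zeroOneLoss_nonneg (l h : 𝒳 → Bool) (x : 𝒳) : 0 ≤ zeroOneLoss l h x := by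
  unfold zeroOneLoss; split_ifs <;> norm_num

lemma zeroOneLoss_le_one (l h : 𝒳 → Bool) (x : 𝒳) : zeroOneLoss l h x ≤ 1 := by
  unfold zeroOneLoss; split_ifs <;> norm_num

lemma zeroOneLoss_congr {l h h' : 𝒳 → Bool} {x : 𝒳} (hx : h x = h' x) :
    zeroOneLoss l h x = zeroOneLoss l h' x := by
  simp [zeroOneLoss, hx]

/-- The weighted loss of `h` on the sample `s`. -/
def weightedLoss [Fintype ι] (l : ι → 𝒳 → Bool) (w : ι → ℝ) (s : ι → 𝒳) (h : 𝒳 → Bool) : ℝ :=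
  ∑ q, w q * zeroOneLoss (l q) h (s q)

/-- The difference of the weighted losses of `h` on the two halves of a double sample. -/
def ghostDiff [Fintype ι] (l : ι → 𝒳 → Bool) (w : ι → ℝ) (h : 𝒳 → Bool) (z : ι → 𝒳 × 𝒳) : ℝ :=
  ∑ q, w q * (zeroOneLoss (l q) h (z q).2 - zeroOneLoss (l q) h (z q).1)

/-- The double samples on which the losses of some hypothesis differ by more than `u`. -/
def ghostEvent [Fintype ι] (H : Set (𝒳 → Bool)) (l : ι → 𝒳 → Bool) (w : ι → ℝ) (u : ℝ) :
    Set (ι → 𝒳 × 𝒳) :=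
  {z | ∃ h ∈ H, u < ghostDiff l w h z}

/-- All the points of a double sample. -/
def doublePoints (z : ι → 𝒳 × 𝒳) : ι ⊕ ι → 𝒳 := Sum.elim (fun q => (z q).1) fun q => (z q).2

/-- Exchange the two points of the pairs selected by `σ`. -/
def swapPairs (σ : ι → Bool) (z : ι → 𝒳 × 𝒳) : ι → 𝒳 × 𝒳 :=
  fun q => if σ q then (z q).swap else z q

lemma ghostDiff_swapPairs [Fintype ι] (l : ι → 𝒳 → Bool) (w : ι → ℝ) (h : 𝒳 → Bool) (z : ι → 𝒳 × 𝒳)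
    (σ : ι → Bool) :
    ghostDiff l w h (swapPairs σ z) =
      ∑ q, if σ q then -(w q * (zeroOneLoss (l q) h (z q).2 - zeroOneLoss (l q) h (z q).1))
        else w q * (zeroOneLoss (l q) h (z q).2 - zeroOneLoss (l q) h (z q).1) := by
  refine Finset.sum_congr rfl fun q _ => ?_
  by_cases hq : σ q
  · simp only [swapPairs, hq, if_true, Prod.fst_swap, Prod.snd_swap]
    ring
  · simp [swapPairs, hq]

open Classical in
/-- For every double sample, few exchanges lead into the ghost event. -/
lemma card_swapPairs_mem_ghostEvent_le [Fintype ι] {H : Set (𝒳 → Bool)} {K : ℕ} (z : ι → 𝒳 × 𝒳)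
    (hK : (traceFamily H (doublePoints z)).card ≤ K) (l : ι → 𝒳 → Bool) (w : ι → ℝ)
    (hw : 0 < ∑ q, w q ^ 2) {u : ℝ} (hu : 0 ≤ u) :
    ((Finset.univ.filter fun σ : ι → Bool => swapPairs σ z ∈ ghostEvent H l w u).card : ℝ) ≤
      K * (2 ^ Fintype.card ι * Real.exp (-u ^ 2 / (2 * ∑ q, w q ^ 2))) := by
  -- One representative hypothesis per trace; its value for sets that are not traces is immaterial.
  -- Losses on the double sample depend only on the trace, so the union bound runs over
  -- representatives.
  have hrep : ∀ A : Finset (ι ⊕ ι), ∃ h : 𝒳 → Bool, A ∈ traceFamily H (doublePoints z) →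
      trueIndices (doublePoints z) h = A := by
    intro A
    by_cases hA : A ∈ traceFamily H (doublePoints z)
    · obtain ⟨h, -, hh⟩ := mem_traceFamily.1 hA
      exact ⟨h, fun _ => hh⟩
    · exact ⟨fun _ => true, fun h => absurd h hA⟩
  choose r hr using hrep
  let c : (𝒳 → Bool) → ι → ℝ := fun h q =>
    w q * (zeroOneLoss (l q) h (z q).2 - zeroOneLoss (l q) h (z q).1)
  have hsub : (Finset.univ.filter fun σ : ι → Bool => swapPairs σ z ∈ ghostEvent H l w u) ⊆
      (traceFamily H (doublePoints z)).biUnion fun A => Finset.univ.filter fun σ : ι → Bool =>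
        u < ∑ q, if σ q then -c (r A) q else c (r A) q := by
    intro σ hσ
    obtain ⟨h, hh, hu'⟩ := (Finset.mem_filter.1 hσ).2
    rw [ghostDiff_swapPairs] at hu'
    have hA : trueIndices (doublePoints z) h ∈ traceFamily H (doublePoints z) :=
      mem_traceFamily.2 ⟨h, hh, rfl⟩
    refine Finset.mem_biUnion.2 ⟨_, hA, Finset.mem_filter.2 ⟨Finset.mem_univ _, ?_⟩⟩
    have heq := trueIndices_eq_iff.1 (hr _ hA)
    have hc : ∀ q, c (r (trueIndices (doublePoints z) h)) q = c h q := by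
      intro q
      have h1 : r (trueIndices (doublePoints z) h) (z q).1 = h (z q).1 := heq (.inl q)
      have h2 : r (trueIndices (doublePoints z) h) (z q).2 = h (z q).2 := heq (.inr q)
      simp only [c]
      rw [zeroOneLoss_congr h1, zeroOneLoss_congr h2]
    simpa only [hc] using hu'
  have hc2 : ∀ h, ∑ q, c h q ^ 2 ≤ ∑ q, w q ^ 2 := by
    intro h
    refine Finset.sum_le_sum fun q _ => ?_
    rw [mul_pow]
    have : (zeroOneLoss (l q) h (z q).2 - zeroOneLoss (l q) h (z q).1) ^ 2 ≤ 1 := by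
      rw [sq_le_one_iff_abs_le_one, abs_le]
      constructor <;> linarith [zeroOneLoss_nonneg (l q) h (z q).2,
        zeroOneLoss_le_one (l q) h (z q).2,
        zeroOneLoss_nonneg (l q) h (z q).1, zeroOneLoss_le_one (l q) h (z q).1]
    exact mul_le_of_le_one_right (sq_nonneg _) this
  calc _ ≤ ((((traceFamily H (doublePoints z)).biUnion fun A => Finset.univ.filter
          fun σ : ι → Bool => u < ∑ q, if σ q then -c (r A) q else c (r A) q).card : ℕ) : ℝ) := by
        exact_mod_cast Finset.card_le_card hsub
    _ ≤ ∑ A ∈ traceFamily H (doublePoints z), ((Finset.univ.filter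
          fun σ : ι → Bool => u < ∑ q, if σ q then -c (r A) q else c (r A) q).card : ℝ) := by
        exact_mod_cast Finset.card_biUnion_le
    _ ≤ ∑ A ∈ traceFamily H (doublePoints z),
          2 ^ Fintype.card ι * Real.exp (-u ^ 2 / (2 * ∑ q, w q ^ 2)) :=
        Finset.sum_le_sum fun A _ => card_signed_sum_gt_le _ hu hw (hc2 _)
    _ ≤ _ := by
        rw [Finset.sum_const, nsmul_eq_mul]
        gcongr

variable [MeasurableSpace 𝒳]

/-- The expectation of the weighted loss of `h`. -/
noncomputable def weightedRisk [Fintype ι] (μ : ι → Measure 𝒳) (l : ι → 𝒳 → Bool) (w : ι → ℝ)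
    (h : 𝒳 → Bool) : ℝ :=
  ∑ q, w q * (μ q).real {x | h x ≠ l q x}

lemma measurableSet_ne_label {l h : 𝒳 → Bool} (hl : Measurable l) (hh : Measurable h) :
    MeasurableSet {x | h x ≠ l x} :=
  (measurableSet_eq_fun hh hl).compl

lemma measurable_zeroOneLoss {l h : 𝒳 → Bool} (hl : Measurable l) (hh : Measurable h) :
    Measurable (zeroOneLoss l h) :=
  Measurable.ite (measurableSet_ne_label hl hh) measurable_const measurable_const

lemma integral_zeroOneLoss (μ : Measure 𝒳) {l h : 𝒳 → Bool} (hl : Measurable l)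
    (hh : Measurable h) : ∫ x, zeroOneLoss l h x ∂μ = μ.real {x | h x ≠ l x} := by
  rw [← integral_indicator_one (measurableSet_ne_label hl hh)]
  refine integral_congr_ae (ae_of_all _ fun x => ?_)
  simp [zeroOneLoss, Set.indicator_apply]

lemma measurable_doublePoints : Measurable (doublePoints : (ι → 𝒳 × 𝒳) → ι ⊕ ι → 𝒳) := by
  refine measurable_pi_lambda _ fun j => ?_
  cases j with
  | inl q => exact measurable_fst.comp (measurable_pi_apply q)
  | inr q => exact measurable_snd.comp (measurable_pi_apply q)

variable [Fintype ι]

lemma measurable_weightedLoss {l : ι → 𝒳 → Bool} (hl : ∀ q, Measurable (l q)) (w : ι → ℝ)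
    {h : 𝒳 → Bool} (hh : Measurable h) : Measurable fun s => weightedLoss l w s h :=
  Finset.measurable_sum _ fun q _ =>
    ((measurable_zeroOneLoss (hl q) hh).comp (measurable_pi_apply q)).const_mul (w q)

/-- **Hoeffding's inequality** for the weighted loss of a single hypothesis. -/
theorem measureReal_weightedLoss_sub_weightedRisk_ge_le (μ : ι → Measure 𝒳)
    [∀ q, IsProbabilityMeasure (μ q)] {l : ι → 𝒳 → Bool} (hl : ∀ q, Measurable (l q)) (w : ι → ℝ)
    {h : 𝒳 → Bool} (hh : Measurable h) {u : ℝ} (hu : 0 ≤ u) :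
    (Measure.pi μ).real {s | u ≤ weightedLoss l w s h - weightedRisk μ l w h} ≤
      Real.exp (-(2 * u ^ 2) / ∑ q, w q ^ 2) := by
  set f : ι → 𝒳 → ℝ := fun q x =>
    w q * (zeroOneLoss (l q) h x - ∫ y, zeroOneLoss (l q) h y ∂(μ q)) with hf
  have hsub : ∀ q, HasSubgaussianMGF (fun s : ι → 𝒳 => f q (s q))
      ((‖w q‖₊ / 2) ^ 2) (Measure.pi μ) := by
    intro q
    have h1 := (hasSubgaussianMGF_of_mem_Icc (μ := μ q) (a := 0) (b := 1)
      (measurable_zeroOneLoss (hl q) hh).aemeasurable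
      (ae_of_all _ fun x => ⟨zeroOneLoss_nonneg _ _ _, zeroOneLoss_le_one _ _ _⟩)).const_mul (w q)
    -- The `q`-th coordinate has law `μ q`, so the sub-Gaussian bound on `𝒳` transfers to the
    -- product space.
    have hm := (measurePreserving_eval μ q)
    rw [← hm.map_eq] at h1
    have h2 := h1.of_map hm.aemeasurable
    rw [hm.map_eq] at h2
    have h3 : HasSubgaussianMGF (fun s : ι → 𝒳 => f q (s q)) _ (Measure.pi μ) := h2
    convert h3 using 1
    refine NNReal.eq ?_
    change (‖w q‖ / 2) ^ 2 = w q ^ 2 * (‖(1 : ℝ) - 0‖ / 2) ^ 2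
    rw [sub_zero, norm_one, Real.norm_eq_abs, div_pow, sq_abs, div_pow, one_pow, mul_one_div]
  have hind : iIndepFun (fun q (s : ι → 𝒳) => f q (s q)) (Measure.pi μ) :=
    iIndepFun_pi fun q =>
      (((measurable_zeroOneLoss (hl q) hh).sub_const _).const_mul (w q)).aemeasurable
  have key := HasSubgaussianMGF.measure_sum_ge_le_of_iIndepFun hind (s := Finset.univ)
    (fun q _ => hsub q) hu
  have e1 : ∀ s : ι → 𝒳, ∑ q, f q (s q) = weightedLoss l w s h - weightedRisk μ l w h := by
    intro s
    rw [weightedLoss, weightedRisk, ← Finset.sum_sub_distrib]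
    refine Finset.sum_congr rfl fun q _ => ?_
    simp only [hf]
    rw [integral_zeroOneLoss _ (hl q) hh]
    ring
  simp_rw [e1] at key
  refine key.trans_eq ?_
  congr 1
  push_cast
  simp only [Real.norm_eq_abs, div_pow, sq_abs]
  rw [← Finset.sum_div]
  -- If all weights vanish, both exponents are divisions by zero and equal 0.
  rcases eq_or_ne (∑ q, w q ^ 2) 0 with h0 | h0
  · simp [h0]
  · field_simp

/-- **Hoeffding's inequality** for the weighted loss of a single hypothesis, lower tail. -/
theorem measureReal_weightedRisk_sub_weightedLoss_ge_le (μ : ι → Measure 𝒳)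
    [∀ q, IsProbabilityMeasure (μ q)] {l : ι → 𝒳 → Bool} (hl : ∀ q, Measurable (l q)) (w : ι → ℝ)
    {h : 𝒳 → Bool} (hh : Measurable h) {u : ℝ} (hu : 0 ≤ u) :
    (Measure.pi μ).real {s | u ≤ weightedRisk μ l w h - weightedLoss l w s h} ≤
      Real.exp (-(2 * u ^ 2) / ∑ q, w q ^ 2) := by
  have key := measureReal_weightedLoss_sub_weightedRisk_ge_le μ hl (fun q => -w q) hh hu
  have e : ∀ s, weightedLoss l (fun q => -w q) s h - weightedRisk μ l (fun q => -w q) h =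
      weightedRisk μ l w h - weightedLoss l w s h := by
    intro s; simp [weightedLoss, weightedRisk]; ring
  simpa only [e, neg_sq] using key

/-- Trace events of a measurable class are null measurable, whatever finite index type is used and
wherever the points come from. -/
lemma IsMeasurableClass.nullMeasurableSet_trace {H : Set (𝒳 → Bool)} (hH : IsMeasurableClass H)
    {Ω : Type*} [MeasurableSpace Ω] (P : Measure Ω) [IsProbabilityMeasure P] {κ : Type*}
    [Fintype κ] {x : Ω → κ → 𝒳} (hx : Measurable x) (b : κ → Bool) :
    NullMeasurableSet {ω | ∃ h ∈ H, ∀ j, h (x ω j) = b j} P := by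
  let e := Fintype.equivFin κ
  let Φ : Ω → Fin (Fintype.card κ) → 𝒳 := fun ω j => x ω (e.symm j)
  have hΦ : Measurable Φ := measurable_pi_lambda _ fun j => (measurable_pi_apply _).comp hx
  have := hH.trace _ (b ∘ e.symm) (P.map Φ) (Measure.isProbabilityMeasure_map hΦ.aemeasurable)
  have h2 := this.preimage (hΦ.measurePreserving P).quasiMeasurePreserving
  convert h2 using 1
  ext ω
  simp only [Set.mem_ofPred_eq, Set.mem_preimage, Φ, Function.comp]
  refine exists_congr fun h => and_congr_right fun _ => ?_
  exact ⟨fun hj j => hj _, fun hj j => by simpa using hj (e j)⟩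

/-- The event is a finite union over the labelings `b` of the double sample: once `b` is fixed, the
loss difference no longer involves `h` and is a measurable function `g b`. -/
lemma nullMeasurableSet_ghostEvent {H : Set (𝒳 → Bool)} (hH : IsMeasurableClass H)
    (P : Measure (ι → 𝒳 × 𝒳)) [IsProbabilityMeasure P] {l : ι → 𝒳 → Bool}
    (hl : ∀ q, Measurable (l q)) (w : ι → ℝ) (u : ℝ) :
    NullMeasurableSet (ghostEvent H l w u) P := by
  classical
  let g : (ι ⊕ ι → Bool) → (ι → 𝒳 × 𝒳) → ℝ := fun b z =>
    ∑ q, w q * (zeroOneLoss (l q) (fun _ => b (.inr q)) (z q).2 -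
      zeroOneLoss (l q) (fun _ => b (.inl q)) (z q).1)
  have hg : ∀ b, Measurable (g b) := fun b => Finset.measurable_sum _ fun q _ =>
    (((measurable_zeroOneLoss (hl q) measurable_const).comp
        (measurable_snd.comp (measurable_pi_apply q))).sub
      ((measurable_zeroOneLoss (hl q) measurable_const).comp
        (measurable_fst.comp (measurable_pi_apply q)))).const_mul (w q)
  have hgD : ∀ b h z, (∀ j, h (doublePoints z j) = b j) → g b z = ghostDiff l w h z := by
    intro b h z hb
    refine Finset.sum_congr rfl fun q _ => ?_
    have h1 := hb (.inl q)
    have h2 := hb (.inr q)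
    simp only [doublePoints, Sum.elim_inl, Sum.elim_inr] at h1 h2
    simp [zeroOneLoss, h1, h2]
  have : ghostEvent H l w u = ⋃ b : ι ⊕ ι → Bool,
      {z | ∃ h ∈ H, ∀ j, h (doublePoints z j) = b j} ∩ {z | u < g b z} := by
    ext z
    simp only [ghostEvent, Set.mem_ofPred_eq, Set.mem_iUnion, Set.mem_inter_iff]
    constructor
    · rintro ⟨h, hh, hu⟩
      exact ⟨fun j => h (doublePoints z j), ⟨h, hh, fun _ => rfl⟩,
        by rwa [hgD _ h z fun _ => rfl]⟩
    · rintro ⟨b, ⟨h, hh, hb⟩, hu⟩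
      exact ⟨h, hh, by rwa [← hgD b h z hb]⟩
  rw [this]
  exact NullMeasurableSet.iUnion fun b =>
    (hH.nullMeasurableSet_trace P measurable_doublePoints b).inter
      (measurableSet_lt measurable_const (hg b)).nullMeasurableSet

lemma measurePreserving_swapPairs (μ : ι → Measure 𝒳) [∀ q, IsProbabilityMeasure (μ q)]
    (σ : ι → Bool) :
    MeasurePreserving (swapPairs σ) (Measure.pi fun q => (μ q).prod (μ q))
      (Measure.pi fun q => (μ q).prod (μ q)) := by
  refine measurePreserving_pi (fun q => (μ q).prod (μ q)) (fun q => (μ q).prod (μ q))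
    (f := fun q p => if σ q then p.swap else p) fun q => ?_
  by_cases h : σ q
  · simpa [h] using! (Measure.measurePreserving_swap (μ := μ q) (ν := μ q))
  · simpa [h] using! MeasurePreserving.id _

/-- The ghost event is unlikely, by exchangeability of the two halves of the double sample. -/
theorem measure_ghostEvent_le {H : Set (𝒳 → Bool)} (hH : IsMeasurableClass H)
    (μ : ι → Measure 𝒳) [∀ q, IsProbabilityMeasure (μ q)] {K : ℕ}
    (hK : ∀ x : ι ⊕ ι → 𝒳, (traceFamily H x).card ≤ K) {l : ι → 𝒳 → Bool}
    (hl : ∀ q, Measurable (l q)) (w : ι → ℝ) (hw : 0 < ∑ q, w q ^ 2) {u : ℝ} (hu : 0 ≤ u) :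
    Measure.pi (fun q => (μ q).prod (μ q)) (ghostEvent H l w u) ≤
      ENNReal.ofReal (K * Real.exp (-u ^ 2 / (2 * ∑ q, w q ^ 2))) := by
  classical
  set Q := Measure.pi fun q => (μ q).prod (μ q)
  set C := ghostEvent H l w u
  set B := Real.exp (-u ^ 2 / (2 * ∑ q, w q ^ 2))
  have hC : NullMeasurableSet C Q := nullMeasurableSet_ghostEvent hH Q hl w u
  have hσ : ∀ σ, NullMeasurableSet (swapPairs σ ⁻¹' C) Q := fun σ =>
    hC.preimage (measurePreserving_swapPairs μ σ).quasiMeasurePreserving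
  -- All swapped events have the same measure, so it suffices to average over the swaps and count
  -- them for each fixed double sample.
  have h1 : (2 ^ Fintype.card ι : ENNReal) * Q C ≤
      2 ^ Fintype.card ι * ENNReal.ofReal (K * B) := by
    calc (2 ^ Fintype.card ι : ENNReal) * Q C
        = ∑ σ : ι → Bool, Q (swapPairs σ ⁻¹' C) := by
          have : ∀ σ : ι → Bool, Q (swapPairs σ ⁻¹' C) = Q C := fun σ =>
            (measurePreserving_swapPairs μ σ).measure_preimage hC
          simp [this]
      _ = ∑ σ : ι → Bool, ∫⁻ z, (swapPairs σ ⁻¹' C).indicator 1 z ∂Q :=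
          Finset.sum_congr rfl fun σ _ => (lintegral_indicator_one₀ (hσ σ)).symm
      _ = ∫⁻ z, ∑ σ : ι → Bool, (swapPairs σ ⁻¹' C).indicator 1 z ∂Q :=
          (lintegral_finsetSum' _ fun σ _ =>
            (aemeasurable_indicator_const_iff (1 : ENNReal)).2 (hσ σ)).symm
      _ ≤ ∫⁻ _, ENNReal.ofReal (K * (2 ^ Fintype.card ι * B)) ∂Q := by
          refine lintegral_mono fun z => ?_
          have hz := card_swapPairs_mem_ghostEvent_le z (hK (doublePoints z)) l w hw hu
          refine le_trans (le_of_eq ?_) (ENNReal.ofReal_le_ofReal hz)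
          simp [Set.indicator_apply, C]
      _ = 2 ^ Fintype.card ι * ENNReal.ofReal (K * B) := by
          rw [lintegral_const, measure_univ, mul_one, mul_left_comm,
            ENNReal.ofReal_mul (by positivity), ENNReal.ofReal_pow (by norm_num)]
          simp
  exact (ENNReal.mul_le_mul_iff_right (by simp) (by simp)).1 h1

/-- **Vapnik–Chervonenkis inequality**, one-sided, for weighted losses on independent, not
necessarily identically distributed, data. -/
theorem measure_exists_weightedRisk_sub_weightedLoss_gt_le {H : Set (𝒳 → Bool)}
    (hH : IsMeasurableClass H) (μ : ι → Measure 𝒳) [∀ q, IsProbabilityMeasure (μ q)] {K : ℕ}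
    (hK : ∀ x : ι ⊕ ι → 𝒳, (traceFamily H x).card ≤ K) {l : ι → 𝒳 → Bool}
    (hl : ∀ q, Measurable (l q)) (w : ι → ℝ) (hw : 0 < ∑ q, w q ^ 2) {t : ℝ} (ht : 0 ≤ t)
    (htw : 2 * ∑ q, w q ^ 2 ≤ t ^ 2) :
    Measure.pi μ {s | ∃ h ∈ H, t < weightedRisk μ l w h - weightedLoss l w s h} ≤
      ENNReal.ofReal (2 * (K * Real.exp (-t ^ 2 / (8 * ∑ q, w q ^ 2)))) := by
  set P := Measure.pi μ
  set Q := Measure.pi fun q => (μ q).prod (μ q)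
  set C := ghostEvent H l w (t / 2)
  let e := MeasurableEquiv.arrowProdEquivProdArrow 𝒳 𝒳 ι
  have he : MeasurePreserving e Q (P.prod P) := measurePreserving_arrowProdEquivProdArrow _ _ _ μ μ
  have hsymm : MeasurePreserving e.symm (P.prod P) Q := he.symm e
  -- The ghost event need not be measurable; a measurable hull of equal measure allows Fubini and
  -- Markov.
  set C' := e.symm ⁻¹' toMeasurable Q C
  have hC' : MeasurableSet C' := e.symm.measurable (measurableSet_toMeasurable _ _)
  have hPC' : P.prod P C' = Q C := by
    rw [hsymm.measure_preimage (measurableSet_toMeasurable _ _).nullMeasurableSet,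
      measure_toMeasurable]
  -- Given a bad `s` with witness `h`, at least half of the ghost samples have deviation below t/2
  -- for the same `h`, and then the two losses differ by more than t/2.
  have hsub : {s | ∃ h ∈ H, t < weightedRisk μ l w h - weightedLoss l w s h} ⊆
      {s | (2⁻¹ : ENNReal) ≤ P (Prod.mk s ⁻¹' C')} := by
    rintro s ⟨h, hh, hs⟩
    have hhm := hH.measurable h hh
    set A := {s' : ι → 𝒳 | t / 2 ≤ weightedRisk μ l w h - weightedLoss l w s' h} with hA
    have hAm : MeasurableSet A :=
      measurableSet_le measurable_const (measurable_const.sub (measurable_weightedLoss hl w hhm))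
    have hAP : P.real A ≤ 2⁻¹ := by
      refine (measureReal_weightedRisk_sub_weightedLoss_ge_le μ hl w hhm (by positivity)).trans ?_
      -- The hypothesis `htw` is used here: Hoeffding at t/2 then gives at most e⁻¹ ≤ 1/2.
      have h1 : -(2 * (t / 2) ^ 2) / ∑ q, w q ^ 2 ≤ -1 := by
        rw [div_le_iff₀ hw]; nlinarith
      have h2 := Real.exp_one_gt_two
      calc _ ≤ Real.exp (-1) := Real.exp_le_exp.2 h1
        _ = (Real.exp 1)⁻¹ := Real.exp_neg 1
        _ ≤ 2⁻¹ := inv_anti₀ (by norm_num) h2.le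
    have hAc : (2⁻¹ : ENNReal) ≤ P Aᶜ := by
      have h3 : (2⁻¹ : ℝ) ≤ P.real Aᶜ := by
        rw [measureReal_compl hAm]; simp; linarith
      rw [← ENNReal.ofReal_le_ofReal_iff (by positivity)] at h3
      rwa [ofReal_measureReal, ENNReal.ofReal_inv_of_pos (by norm_num), ENNReal.ofReal_ofNat] at h3
    refine hAc.trans (measure_mono fun s' hs' => ?_)
    have hs'' : weightedRisk μ l w h - weightedLoss l w s' h < t / 2 := not_le.1 hs'
    refine subset_toMeasurable Q C ⟨h, hh, ?_⟩
    have : ghostDiff l w h (e.symm (s, s')) = weightedLoss l w s' h - weightedLoss l w s h := by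
      rw [weightedLoss, weightedLoss, ← Finset.sum_sub_distrib]
      exact Finset.sum_congr rfl fun q _ => mul_sub _ _ _
    rw [this]
    linarith
  have hmark := mul_meas_ge_le_lintegral (μ := P) (measurable_measure_prodMk_left (ν := P) hC')
    2⁻¹
  rw [← Measure.prod_apply hC', hPC'] at hmark
  have hfin : P {s | (2⁻¹ : ENNReal) ≤ P (Prod.mk s ⁻¹' C')} ≤ 2 * Q C := by
    calc _ = 2 * (2⁻¹ * P {s | (2⁻¹ : ENNReal) ≤ P (Prod.mk s ⁻¹' C')}) := by
          rw [← mul_assoc, ENNReal.mul_inv_cancel (by simp) (by simp), one_mul]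
      _ ≤ _ := by gcongr
  refine (measure_mono hsub).trans (hfin.trans ?_)
  rw [ENNReal.ofReal_mul (by norm_num), ENNReal.ofReal_ofNat]
  gcongr
  refine (measure_ghostEvent_le hH μ hK hl w hw (by positivity)).trans_eq ?_
  have : -(t / 2) ^ 2 / (2 * ∑ q, w q ^ 2) = -t ^ 2 / (8 * ∑ q, w q ^ 2) := by
    field_simp
    ring
  rw [this]

end Deviation

/-! ### Classes of finite VC dimension are totally bounded in `L¹` -/

section Net

variable {𝒳 : Type*} [MeasurableSpace 𝒳]

/-- Probabilistic method: two separated hypotheses agree on `K` random points with probability at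
most (1-η)^K ≤ e^(-ηK). By the union bound over pairs some sample distinguishes all of `F`, and
Sauer–Shelah bounds the number of traces on it. -/
lemma card_le_of_separated (P : Measure 𝒳) [IsProbabilityMeasure P] {H : Set (𝒳 → Bool)}
    (hH : ∀ h ∈ H, Measurable h) {d : ℕ} (hd : classVCDim H ≤ d) {η : ℝ} {F : Finset (𝒳 → Bool)}
    (hF : ∀ f ∈ F, f ∈ H) (hsep : ∀ f ∈ F, ∀ g ∈ F, f ≠ g → η < P.real {x | f x ≠ g x}) {K : ℕ}
    (hK : (F.card : ℝ) ^ 2 * Real.exp (-η) ^ K < 1) : F.card ≤ (K + 1) ^ d := by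
  classical
  let Q : Measure (Fin K → 𝒳) := Measure.pi fun _ => P
  let E : (𝒳 → Bool) × (𝒳 → Bool) → Set (Fin K → 𝒳) := fun p => {x | ∀ j, p.1 (x j) = p.2 (x j)}
  have hE : ∀ p ∈ F.offDiag, Q.real (E p) ≤ Real.exp (-η) ^ K := by
    intro p hp
    obtain ⟨h1, h2, h12⟩ := Finset.mem_offDiag.1 hp
    have hs := hsep _ h1 _ h2 h12
    have hm := (measurableSet_ne_label (hH _ (hF _ h2)) (hH _ (hF _ h1)))
    have : E p = Set.univ.pi fun _ => {x | p.1 x ≠ p.2 x}ᶜ := by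
      ext x; simp [E]
    rw [this, Measure.real, Measure.pi_pi, Finset.prod_const, Finset.card_univ, Fintype.card_fin,
      ENNReal.toReal_pow]
    refine pow_le_pow_left₀ ENNReal.toReal_nonneg ?_ K
    change P.real _ ≤ _
    rw [measureReal_compl hm, probReal_univ]
    linarith [Real.add_one_le_exp (-η)]
  have hU : Q.real (⋃ p ∈ F.offDiag, E p) < 1 := by
    calc _ ≤ ∑ p ∈ F.offDiag, Q.real (E p) := measureReal_biUnion_finset_le _ _
      _ ≤ ∑ p ∈ F.offDiag, Real.exp (-η) ^ K := Finset.sum_le_sum hE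
      _ ≤ (F.card : ℝ) ^ 2 * Real.exp (-η) ^ K := by
        rw [Finset.sum_const, nsmul_eq_mul]
        gcongr
        rw [Finset.offDiag_card, sq]
        exact_mod_cast Nat.sub_le _ _
      _ < 1 := hK
  obtain ⟨x, hx⟩ : ∃ x, x ∉ ⋃ p ∈ F.offDiag, E p := by
    by_contra! hall
    rw [Set.eq_univ_of_forall hall, probReal_univ] at hU
    exact lt_irrefl _ hU
  have hinj : Set.InjOn (trueIndices x) F := by
    intro f hf g hg hfg
    by_contra hne
    refine hx (Set.mem_iUnion₂.2 ⟨(f, g), Finset.mem_offDiag.2 ⟨hf, hg, hne⟩, ?_⟩)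
    exact trueIndices_eq_iff.1 hfg
  rw [← Finset.card_image_of_injOn hinj]
  calc _ ≤ (traceFamily H x).card := Finset.card_le_card fun A hA => by
        obtain ⟨f, hf, rfl⟩ := Finset.mem_image.1 hA
        exact mem_traceFamily.2 ⟨f, hF f hf, rfl⟩
    _ ≤ _ := (card_traceFamily_le hd x).trans (sum_range_choose_le_pow _ _)
    _ = (K + 1) ^ d := by simp

lemma exists_pow_mul_exp_lt (d : ℕ) {η : ℝ} (hη : 0 < η) :
    ∃ K : ℕ, (((K + 1) ^ d + 1 : ℕ) : ℝ) ^ 2 * Real.exp (-η) ^ K < 1 := by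
  have hr : |Real.exp (-η)| < 1 := by
    rw [abs_of_pos (Real.exp_pos _)]; exact Real.exp_lt_one_iff.2 (by linarith)
  -- The shifted sequence has base and exponent K+1; the threshold e^(-η)/4 below absorbs the
  -- surplus factor e^(-η) and the factor 4 from the summand +1.
  have ht := (tendsto_pow_const_mul_const_pow_of_abs_lt_one (2 * d) hr).comp
    (Filter.tendsto_add_atTop_nat 1)
  obtain ⟨K, hK⟩ := (ht.eventually (gt_mem_nhds
    (show (0 : ℝ) < Real.exp (-η) / 4 by positivity))).exists
  refine ⟨K, ?_⟩
  simp only [Function.comp, pow_succ (Real.exp (-η)) K] at hK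
  have h1 : (((K + 1) ^ d + 1 : ℕ) : ℝ) ^ 2 ≤ 4 * ((K + 1 : ℕ) : ℝ) ^ (2 * d) := by
    have : (1 : ℝ) ≤ ((K + 1 : ℕ) : ℝ) ^ d := one_le_pow₀ (by norm_cast; omega)
    rw [mul_comm 2 d, pow_mul]
    push_cast at this ⊢
    nlinarith
  have hp : 0 < Real.exp (-η) := Real.exp_pos _
  have h2 : ((K + 1 : ℕ) : ℝ) ^ (2 * d) * Real.exp (-η) ^ K < 1 / 4 := by
    rw [← mul_assoc, lt_div_iff₀ (by norm_num)] at hK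
    rw [lt_div_iff₀ (by norm_num)]
    nlinarith
  calc _ ≤ 4 * ((K + 1 : ℕ) : ℝ) ^ (2 * d) * Real.exp (-η) ^ K := by gcongr
    _ < 1 := by linarith

lemma exists_finset_net_of_isProbabilityMeasure (P : Measure 𝒳) [IsProbabilityMeasure P]
    {H : Set (𝒳 → Bool)} (hH : ∀ h ∈ H, Measurable h) {d : ℕ} (hd : classVCDim H ≤ d) {η : ℝ}
    (hη : 0 < η) :
    ∃ F : Finset (𝒳 → Bool), (∀ f ∈ F, f ∈ H) ∧
      ∀ h ∈ H, ∃ f ∈ F, P.real {x | h x ≠ f x} ≤ η := by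
  classical
  by_contra! hno
  -- Greedy choice: without a finite net, a separated family can always be enlarged, eventually
  -- beyond the bound of `card_le_of_separated`.
  have hlarge : ∀ n : ℕ, ∃ F : Finset (𝒳 → Bool), F.card = n ∧ (∀ f ∈ F, f ∈ H) ∧
      ∀ f ∈ F, ∀ g ∈ F, f ≠ g → η < P.real {x | f x ≠ g x} := by
    intro n
    induction n with
    | zero => exact ⟨∅, by simp⟩
    | succ n ih =>
      obtain ⟨F, hn, hF, hsep⟩ := ih
      obtain ⟨h, hh, hfar⟩ := hno F hF
      have hnot : h ∉ F := fun hmem => by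
        have := hfar h hmem
        simp at this
        linarith
      refine ⟨insert h F, by rw [Finset.card_insert_of_notMem hnot, hn], ?_, ?_⟩
      · intro f hf
        rcases Finset.mem_insert.1 hf with rfl | hf
        · exact hh
        · exact hF f hf
      · intro f hf g hg hne
        rcases Finset.mem_insert.1 hf with rfl | hf'
        · rcases Finset.mem_insert.1 hg with rfl | hg'
          · exact absurd rfl hne
          · exact hfar g hg'
        · rcases Finset.mem_insert.1 hg with rfl | hg'
          · simpa only [ne_comm] using hfar f hf'
          · exact hsep f hf' g hg' hne
  obtain ⟨K, hK⟩ := exists_pow_mul_exp_lt d hη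
  obtain ⟨F, hn, hF, hsep⟩ := hlarge ((K + 1) ^ d + 1)
  have := card_le_of_separated P hH hd hF hsep (K := K) (by rwa [hn])
  omega

/-- A class of finite VC dimension is totally bounded for the `L¹` distance of any finite
measure. -/
theorem exists_finset_net (ρ : Measure 𝒳) [IsFiniteMeasure ρ] {H : Set (𝒳 → Bool)}
    (hH : ∀ h ∈ H, Measurable h) {d : ℕ} (hd : classVCDim H ≤ d) {η : ℝ} (hη : 0 < η) :
    ∃ F : Finset (𝒳 → Bool), (∀ f ∈ F, f ∈ H) ∧
      ∀ h ∈ H, ∃ f ∈ F, ρ.real {x | h x ≠ f x} ≤ η := by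
  rcases H.eq_empty_or_nonempty with rfl | ⟨h₀, hh₀⟩
  · exact ⟨∅, by simp⟩
  rcases eq_or_ne ρ 0 with rfl | hρ
  · exact ⟨{h₀}, by simpa using hh₀, fun h _ => ⟨h₀, by simp, by simpa using hη.le⟩⟩
  have hu : ρ Set.univ ≠ 0 := by simpa using hρ
  have hpos : 0 < ρ.real Set.univ := ENNReal.toReal_pos hu (measure_ne_top _ _)
  have : IsProbabilityMeasure (ρ[|Set.univ]) := cond_isProbabilityMeasure hu
  obtain ⟨F, hF, hnet⟩ := exists_finset_net_of_isProbabilityMeasure (ρ[|Set.univ]) hH hd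
    (div_pos hη hpos)
  refine ⟨F, hF, fun h hh => ?_⟩
  obtain ⟨f, hf, hle⟩ := hnet h hh
  refine ⟨f, hf, ?_⟩
  rw [Measure.real, cond_apply MeasurableSet.univ, Set.univ_inter, ENNReal.toReal_mul,
    ENNReal.toReal_inv, le_div_iff₀ hpos] at hle
  calc _ = (ρ.real Set.univ)⁻¹ * ρ.real {x | h x ≠ f x} * ρ.real Set.univ := by field_simp
    _ ≤ η := hle

end Net

/-! ### Polynomial approximation away from the origin -/

section Polynomial

variable {n : ℕ} {X : Set (Fin n → ℝ)}

lemma measurableSet_coe_ne_zero : MeasurableSet {x : X | (x : Fin n → ℝ) ≠ 0} :=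
  (measurable_subtype_coe (measurableSet_singleton 0)).compl

lemma continuous_eval_coe (p : MvPolynomial (Fin n) ℝ) :
    Continuous fun x : X => MvPolynomial.eval (x : Fin n → ℝ) p :=
  p.continuous_eval.comp continuous_subtype_val

lemma Continuous.integrable_of_compactSpace {α : Type*} [TopologicalSpace α] [CompactSpace α]
    [MeasurableSpace α] [OpensMeasurableSpace α] {ρ : Measure α} [IsFiniteMeasure ρ] {f : α → ℝ}
    (hf : Continuous f) : Integrable f ρ :=
  hf.integrable_of_hasCompactSupport (HasCompactSupport.of_compactSpace f)

/-- **Stone–Weierstrass theorem** for polynomials in several variables. -/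
lemma exists_mvPolynomial_near [CompactSpace X] {g : X → ℝ} (hg : Continuous g) {η : ℝ}
    (hη : 0 < η) :
    ∃ q : MvPolynomial (Fin n) ℝ, ∀ x : X, |g x - MvPolynomial.eval (x : Fin n → ℝ) q| < η := by
  let coord : Fin n → C(X, ℝ) := fun i =>
    ⟨fun x => (x : Fin n → ℝ) i, (continuous_apply i).comp continuous_subtype_val⟩
  let A : Subalgebra ℝ C(X, ℝ) := (MvPolynomial.aeval coord).range
  have hA : A.SeparatesPoints := by
    intro x y hxy
    obtain ⟨i, hi⟩ : ∃ i, (x : Fin n → ℝ) i ≠ (y : Fin n → ℝ) i := by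
      by_contra! h
      exact hxy (Subtype.ext (funext h))
    exact ⟨coord i, ⟨coord i, ⟨MvPolynomial.X i, by simp⟩, rfl⟩, hi⟩
  obtain ⟨⟨f, q, hq⟩, hf⟩ :=
    ContinuousMap.exists_mem_subalgebra_near_continuous_of_separatesPoints A hA g hg η hη
  refine ⟨q, fun x => ?_⟩
  have h1 : f x = MvPolynomial.eval (x : Fin n → ℝ) q := by
    rw [← hq]
    change ContinuousMap.evalAlgHom ℝ ℝ x (MvPolynomial.aeval coord q) = _
    rw [MvPolynomial.comp_aeval_apply, MvPolynomial.aeval_eq_eval]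
    rfl
  rw [← h1, abs_sub_comm]
  exact hf x

lemma exists_mvPolynomial_integral_abs_sub_le [CompactSpace X] (ρ : Measure X)
    [IsFiniteMeasure ρ] {u : X → ℝ} (hu : Integrable u ρ) {η : ℝ} (hη : 0 < η) :
    ∃ q : MvPolynomial (Fin n) ℝ,
      ∫ x : X, |u x - MvPolynomial.eval (x : Fin n → ℝ) q| ∂ρ ≤ η := by
  obtain ⟨g, hg, hgi⟩ := hu.exists_boundedContinuous_integral_sub_le (half_pos hη)
  set M := ρ.real Set.univ
  have hM : 0 ≤ M := measureReal_nonneg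
  obtain ⟨q, hq⟩ := exists_mvPolynomial_near g.continuous
    (show 0 < η / (2 * (M + 1)) by positivity)
  have hqi : Integrable (fun x : X => MvPolynomial.eval (x : Fin n → ℝ) q) ρ :=
    (continuous_eval_coe q).integrable_of_compactSpace
  refine ⟨q, ?_⟩
  calc ∫ x : X, |u x - MvPolynomial.eval (x : Fin n → ℝ) q| ∂ρ
      ≤ ∫ x : X, (‖u x - g x‖ + η / (2 * (M + 1))) ∂ρ := by
        refine integral_mono (hu.sub hqi).abs ((hu.sub hgi).norm.add (integrable_const _))
          fun x => ?_
        have := abs_sub_le (u x) (g x) (MvPolynomial.eval (x : Fin n → ℝ) q)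
        simp only [Real.norm_eq_abs]
        linarith [hq x]
    _ = ∫ x : X, ‖u x - g x‖ ∂ρ + M * (η / (2 * (M + 1))) := by
        have hi : Integrable (fun x => ‖u x - g x‖) ρ := (hu.sub hgi).norm
        rw [integral_add hi (integrable_const _), integral_const, smul_eq_mul]
    _ ≤ η / 2 + η / 2 := by
        gcongr
        rw [← mul_div_assoc, div_le_div_iff₀ (by positivity) (by norm_num)]
        nlinarith
    _ = η := add_halves η

/-- There are polynomials with value `1` at the origin that are as small as desired in `L¹` away
from it. -/
lemma exists_mvPolynomial_integral_abs_le [CompactSpace X] (ρ : Measure X) [IsFiniteMeasure ρ]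
    {η : ℝ} (hη : 0 < η) :
    ∃ b : MvPolynomial (Fin n) ℝ, MvPolynomial.eval 0 b = 1 ∧
      ∫ x : X in {x | (x : Fin n → ℝ) ≠ 0}, |MvPolynomial.eval (x : Fin n → ℝ) b| ∂ρ ≤ η := by
  let r : MvPolynomial (Fin n) ℝ := ∑ i, MvPolynomial.X i ^ 2
  have hr : ∀ x, MvPolynomial.eval x r = ∑ i, x i ^ 2 := fun x => by simp [r]
  obtain ⟨R, hR⟩ : ∃ R, ∀ x : X, MvPolynomial.eval (x : Fin n → ℝ) r ≤ R := by
    obtain ⟨R, hR⟩ := (isCompact_range (continuous_eval_coe (X := X) r)).bddAbove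
    exact ⟨R, fun x => hR ⟨x, rfl⟩⟩
  -- The maximum keeps the divisor positive even if `X` is empty or only contains the origin.
  set R' := max R 1
  have hR' : 0 < R' := zero_lt_one.trans_le (le_max_right _ _)
  let s : X → ℝ := fun x => 1 - (∑ i, (x : Fin n → ℝ) i ^ 2) / R'
  have hs0 : ∀ x, 0 ≤ s x := fun x => by
    have := (hR x).trans (le_max_left R 1)
    rw [hr] at this
    simp only [s, sub_nonneg]
    exact (div_le_one hR').2 this
  have hs1 : ∀ x, s x ≤ 1 := fun x => by
    have : 0 ≤ (∑ i, (x : Fin n → ℝ) i ^ 2) / R' := by positivity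
    simp only [s]; linarith
  have hs : ∀ x : X, (x : Fin n → ℝ) ≠ 0 → s x < 1 := fun x hx => by
    obtain ⟨i, hi⟩ := Function.ne_iff.1 hx
    have : 0 < ∑ i, (x : Fin n → ℝ) i ^ 2 :=
      Finset.sum_pos' (fun i _ => sq_nonneg _) ⟨i, Finset.mem_univ _, by
        have : (x : Fin n → ℝ) i ≠ 0 := hi
        positivity⟩
    have := div_pos this hR'
    simp only [s]; linarith
  -- Powers of 1 - |x|²/R' equal 1 at the origin and tend to 0 at every other point of `X`,
  -- boundedly, so dominated convergence applies.
  let b : ℕ → MvPolynomial (Fin n) ℝ := fun k => (1 - MvPolynomial.C R'⁻¹ * r) ^ k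
  have hb : ∀ k (x : X), MvPolynomial.eval (x : Fin n → ℝ) (b k) = s x ^ k := fun k x => by
    simp only [b, s, map_pow, map_sub, map_one, map_mul, MvPolynomial.eval_C, hr]
    rw [div_eq_inv_mul]
  have hlim : Filter.Tendsto
      (fun k => ∫ x : X in {x | (x : Fin n → ℝ) ≠ 0}, |MvPolynomial.eval (x : Fin n → ℝ) (b k)| ∂ρ)
      Filter.atTop (nhds (∫ _ : X in {x | (x : Fin n → ℝ) ≠ 0}, (0 : ℝ) ∂ρ)) := by
    refine tendsto_integral_of_dominated_convergence (fun _ => 1) (fun k => ?_)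
      (integrable_const _) (fun k => ae_of_all _ fun x => ?_) ?_
    · exact (continuous_eval_coe (b k)).abs.aestronglyMeasurable
    · rw [hb, Real.norm_eq_abs, abs_abs, abs_of_nonneg (pow_nonneg (hs0 x) k)]
      exact pow_le_one₀ (hs0 x) (hs1 x)
    · filter_upwards [ae_restrict_mem measurableSet_coe_ne_zero] with x hx
      have := (tendsto_pow_atTop_nhds_zero_of_lt_one (hs0 x) (hs x hx)).abs
      simpa only [hb, abs_zero] using this
  rw [integral_zero] at hlim
  obtain ⟨k, hk⟩ := (hlim.eventually (gt_mem_nhds hη)).exists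
  exact ⟨b k, by simp [b, r], hk.le⟩

/-- Polynomials without constant term are dense in `L¹` among the functions vanishing at the
origin. -/
theorem exists_constantCoeff_eq_zero_integral_abs_sub_le [CompactSpace X] (ρ : Measure X)
    [IsFiniteMeasure ρ] {u : X → ℝ} (hu : Integrable u ρ)
    (hu0 : ∀ x : X, (x : Fin n → ℝ) = 0 → u x = 0) {η : ℝ} (hη : 0 < η) :
    ∃ p : MvPolynomial (Fin n) ℝ, MvPolynomial.constantCoeff p = 0 ∧
      ∫ x : X, |u x - MvPolynomial.eval (x : Fin n → ℝ) p| ∂ρ ≤ η := by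
  set E : Set X := {x | (x : Fin n → ℝ) ≠ 0}
  obtain ⟨q, hq⟩ := exists_mvPolynomial_integral_abs_sub_le (ρ.restrict E) hu.restrict
    (half_pos hη)
  set c := MvPolynomial.eval 0 q
  obtain ⟨b, hb0, hb⟩ := exists_mvPolynomial_integral_abs_le ρ
    (show 0 < η / (2 * (|c| + 1)) by positivity)
  -- Subtracting `c * b` removes the constant term of `q` at small L¹ cost off the origin; at the
  -- origin both `u` and `p` vanish.
  set p := q - MvPolynomial.C c * b with hp
  have hp0 : MvPolynomial.eval 0 p = 0 := by
    rw [hp, map_sub, map_mul, MvPolynomial.eval_C, hb0, mul_one, sub_self]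
  refine ⟨p, by rw [← hp0, MvPolynomial.eval_zero], ?_⟩
  have hi : ∀ f : MvPolynomial (Fin n) ℝ,
      Integrable (fun x : X => MvPolynomial.eval (x : Fin n → ℝ) f) (ρ.restrict E) := fun f =>
    (continuous_eval_coe f).integrable_of_compactSpace
  rw [← setIntegral_eq_integral_of_forall_compl_eq_zero (s := E) (fun x hx => by
    have hx0 : (x : Fin n → ℝ) = 0 := not_not.1 hx
    rw [hu0 x hx0, hx0, hp0, sub_zero, abs_zero])]
  calc ∫ x : X in E, |u x - MvPolynomial.eval (x : Fin n → ℝ) p| ∂ρ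
      ≤ ∫ x : X in E, (|u x - MvPolynomial.eval (x : Fin n → ℝ) q| +
          |c| * |MvPolynomial.eval (x : Fin n → ℝ) b|) ∂ρ := by
        refine integral_mono (hu.restrict.sub (hi p)).abs
          ((hu.restrict.sub (hi q)).abs.add ((hi b).abs.const_mul _)) fun x => ?_
        have e : u x - MvPolynomial.eval (x : Fin n → ℝ) p =
            (u x - MvPolynomial.eval (x : Fin n → ℝ) q) +
              c * MvPolynomial.eval (x : Fin n → ℝ) b := by simp [hp]; ring
        simp only [e, ← abs_mul]
        exact abs_add_le _ _
    _ = ∫ x : X in E, |u x - MvPolynomial.eval (x : Fin n → ℝ) q| ∂ρ +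
          |c| * ∫ x : X in E, |MvPolynomial.eval (x : Fin n → ℝ) b| ∂ρ := by
        have h1 : Integrable (fun x : X => |u x - MvPolynomial.eval (x : Fin n → ℝ) q|)
          (ρ.restrict E) := (hu.restrict.sub (hi q)).abs
        rw [integral_add h1 ((hi b).abs.const_mul _), integral_const_mul]
    _ ≤ η / 2 + |c| * (η / (2 * (|c| + 1))) := by gcongr
    _ ≤ η / 2 + η / 2 := by
        gcongr
        rw [← mul_div_assoc, div_le_div_iff₀ (by positivity) (by norm_num)]
        nlinarith [abs_nonneg c]
    _ = η := add_halves η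

end Polynomial

/-! ### Comparing two domains by their label-wise moments -/

namespace LabeledDomain

variable {𝒳 : Type*} [MeasurableSpace 𝒳]

instance (D : LabeledDomain 𝒳) : IsProbabilityMeasure D.μ := D.isProb

lemma measurableSet_label_eq (D : LabeledDomain 𝒳) (c : Bool) :
    MeasurableSet {x | D.label x = c} :=
  D.measurable_label (measurableSet_singleton c)

/-- The factor `p(c)` cancels the normalization of the conditional measure; if `p(c) = 0` both sides
are 0. -/
lemma labelProb_mul_integral_condLabel (D : LabeledDomain 𝒳) (c : Bool) (g : 𝒳 → ℝ) :
    D.labelProb c * ∫ x, g x ∂(D.condLabel c) = ∫ x in {x | D.label x = c}, g x ∂D.μ := by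
  rw [labelProb, condLabel, ProbabilityTheory.cond, integral_smul_measure, ENNReal.toReal_inv,
    smul_eq_mul, ← mul_assoc]
  by_cases h : D.μ {x | D.label x = c} = 0
  · rw [Measure.restrict_eq_zero.2 h]; simp
  · rw [Measure.real, mul_inv_cancel₀, one_mul]
    exact ne_of_gt (ENNReal.toReal_pos h (measure_ne_top _ _))

/-- The difference between the integrals of `g` over the points with label `c` of two domains. -/
noncomputable def labelDiff (D D' : LabeledDomain 𝒳) (c : Bool) (g : 𝒳 → ℝ) : ℝ :=
  ∫ x in {x | D.label x = c}, g x ∂D.μ - ∫ x in {x | D'.label x = c}, g x ∂D'.μ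

lemma abs_labelDiff_sub_le {D D' : LabeledDomain 𝒳} {ρ : Measure 𝒳} (hρ : D.μ + D'.μ ≤ ρ)
    (c : Bool) {f g : 𝒳 → ℝ} (hf : Integrable f ρ) (hg : Integrable g ρ) :
    |D.labelDiff D' c f - D.labelDiff D' c g| ≤ ∫ x, |f x - g x| ∂ρ := by
  have hD : D.μ ≤ ρ := (Measure.le_add_right le_rfl).trans hρ
  have hD' : D'.μ ≤ ρ := (Measure.le_add_left le_rfl).trans hρ
  have hfg : Integrable (fun x => |f x - g x|) ρ := (hf.sub hg).abs
  have key : ∀ (ν : Measure 𝒳) (A : Set 𝒳), ν ≤ ρ →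
      |∫ x in A, f x ∂ν - ∫ x in A, g x ∂ν| ≤ ∫ x, |f x - g x| ∂ν := by
    intro ν A hν
    rw [← integral_sub (hf.mono_measure hν).integrableOn (hg.mono_measure hν).integrableOn]
    exact (abs_integral_le_integral_abs).trans
      (setIntegral_le_integral (hfg.mono_measure hν) (ae_of_all _ fun x => abs_nonneg _))
  calc |D.labelDiff D' c f - D.labelDiff D' c g|
      = |(∫ x in {x | D.label x = c}, f x ∂D.μ - ∫ x in {x | D.label x = c}, g x ∂D.μ) -
        (∫ x in {x | D'.label x = c}, f x ∂D'.μ - ∫ x in {x | D'.label x = c}, g x ∂D'.μ)| := by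
        rw [labelDiff, labelDiff]; congr 1; ring
    _ ≤ ∫ x, |f x - g x| ∂D.μ + ∫ x, |f x - g x| ∂D'.μ :=
        (abs_sub _ _).trans (add_le_add (key _ _ hD) (key _ _ hD'))
    _ = ∫ x, |f x - g x| ∂(D.μ + D'.μ) :=
        (integral_add_measure (hfg.mono_measure hD) (hfg.mono_measure hD')).symm
    _ ≤ ∫ x, |f x - g x| ∂ρ :=
        integral_mono_measure hρ (ae_of_all _ fun x => abs_nonneg _) hfg

/-- The measure of a set that depends on the label is the sum of two integrals over the points
with a given label. -/
lemma sum_setIntegral_indicator (D : LabeledDomain 𝒳) {E : Bool → Set 𝒳}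
    (hE : ∀ c, MeasurableSet (E c)) :
    ∑ c, ∫ x in {x | D.label x = c}, (E c).indicator 1 x ∂D.μ =
      D.μ.real {x | x ∈ E (D.label x)} := by
  have h1 : ∀ c, ∫ x in {x | D.label x = c}, (E c).indicator (1 : 𝒳 → ℝ) x ∂D.μ =
      D.μ.real (E c ∩ {x | D.label x = c}) := fun c => by
    rw [integral_indicator_one (hE c), measureReal_restrict_apply (hE c)]
  simp_rw [h1]
  rw [Fintype.sum_bool, ← measureReal_union _ ((hE false).inter (D.measurableSet_label_eq false))]
  · congr 1
    ext x
    simp only [Set.mem_union, Set.mem_inter_iff, Set.mem_ofPred_eq]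
    cases h : D.label x <;> simp
  · rw [Set.disjoint_left]
    rintro x ⟨-, h1⟩ ⟨-, h2⟩
    simp only [Set.mem_ofPred_eq] at h1 h2
    simp [h1] at h2

lemma sum_labelDiff_indicator (D D' : LabeledDomain 𝒳) {E : Bool → Set 𝒳}
    (hE : ∀ c, MeasurableSet (E c)) :
    ∑ c, D.labelDiff D' c ((E c).indicator 1) =
      D.μ.real {x | x ∈ E (D.label x)} - D'.μ.real {x | x ∈ E (D'.label x)} := by
  simp only [labelDiff, Finset.sum_sub_distrib, sum_setIntegral_indicator _ hE]

end LabeledDomain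

/-! ### Control of label-wise integrals by moments, uniformly over the class -/

section Moments

variable {n : ℕ} {X : Set (Fin n → ℝ)}

lemma labelMomentDiv_eq_sum_labelDiff (k : ℕ) (D D' : LabeledDomain X) :
    labelMomentDiv k D D' = ∑ c : Bool, ∑ e ∈ Finset.piAntidiag (Finset.univ : Finset (Fin n)) k,
      |D.labelDiff D' c fun x => ∏ j, (x : Fin n → ℝ) j ^ e j| := by
  simp only [labelMomentDiv, LabeledDomain.labelProb_mul_integral_condLabel,
    LabeledDomain.labelDiff]

lemma sum_abs_labelDiff_le_labelMomentDiv (k : ℕ) (D D' : LabeledDomain X) (c : Bool) :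
    ∑ e ∈ Finset.piAntidiag (Finset.univ : Finset (Fin n)) k,
      |D.labelDiff D' c fun x => ∏ j, (x : Fin n → ℝ) j ^ e j| ≤ labelMomentDiv k D D' := by
  rw [labelMomentDiv_eq_sum_labelDiff]
  exact Finset.single_le_sum (f := fun c => ∑ e ∈ Finset.piAntidiag Finset.univ k,
    |D.labelDiff D' c fun x => ∏ j, (x : Fin n → ℝ) j ^ e j|)
    (fun _ _ => Finset.sum_nonneg fun _ _ => abs_nonneg _) (Finset.mem_univ c)

lemma labelDiff_eval [CompactSpace X] (D D' : LabeledDomain X) (c : Bool)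
    (p : MvPolynomial (Fin n) ℝ) :
    (D.labelDiff D' c fun x => MvPolynomial.eval (x : Fin n → ℝ) p) =
      ∑ e ∈ p.support, p.coeff e * D.labelDiff D' c fun x => ∏ j, (x : Fin n → ℝ) j ^ e j := by
  have key : ∀ ν : Measure X, IsFiniteMeasure ν →
      ∫ x : X, MvPolynomial.eval (x : Fin n → ℝ) p ∂ν =
        ∑ e ∈ p.support, p.coeff e * ∫ x : X, ∏ j, (x : Fin n → ℝ) j ^ e j ∂ν := by
    intro ν _
    simp_rw [MvPolynomial.eval_eq']
    rw [integral_finsetSum]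
    · simp_rw [integral_const_mul]
    · intro e _
      exact (continuous_const.mul (continuous_finsetProd _ fun i _ =>
        ((continuous_apply i).comp continuous_subtype_val).pow _)).integrable_of_compactSpace
  simp only [LabeledDomain.labelDiff, mul_sub, Finset.sum_sub_distrib]
  rw [key _ inferInstance, key _ inferInstance]

/-- The label-wise moment divergences control the integrals of polynomials without constant
term. -/
lemma abs_labelDiff_eval_le [CompactSpace X] (D D' : LabeledDomain X) (c : Bool)
    {p : MvPolynomial (Fin n) ℝ} (hp : MvPolynomial.constantCoeff p = 0) {k : ℕ} {a : ℝ}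
    (hk : p.totalDegree ≤ k) (ha : ∑ e ∈ p.support, |p.coeff e| ≤ a) :
    |D.labelDiff D' c fun x => MvPolynomial.eval (x : Fin n → ℝ) p| ≤
      a * ∑ j ∈ Finset.Icc 1 k, labelMomentDiv j D D' := by
  classical
  have ha0 : 0 ≤ a := (Finset.sum_nonneg fun _ _ => abs_nonneg _).trans ha
  let M : (Fin n → ℕ) → ℝ := fun e => |D.labelDiff D' c fun x => ∏ j, (x : Fin n → ℝ) j ^ e j|
  -- The vanishing constant term excludes degree 0, so moments of orders 1 to `k` suffice.
  have hdeg : ∀ e ∈ p.support, ∑ j, e j ∈ Finset.Icc 1 k := by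
    intro e he
    rw [Finset.mem_Icc]
    constructor
    · rw [Nat.one_le_iff_ne_zero]
      intro h0
      have : e = 0 := by
        ext j
        exact (Finset.sum_eq_zero_iff.1 h0) j (Finset.mem_univ j)
      rw [this, MvPolynomial.mem_support_iff] at he
      exact he hp
    · refine le_trans ?_ ((MvPolynomial.le_totalDegree he).trans hk)
      rw [Finsupp.sum_fintype _ _ fun _ => rfl]
  rw [labelDiff_eval]
  calc |∑ e ∈ p.support, p.coeff e * D.labelDiff D' c fun x => ∏ j, (x : Fin n → ℝ) j ^ e j|
      ≤ ∑ e ∈ p.support, |p.coeff e| * M e := by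
        refine (Finset.abs_sum_le_sum_abs _ _).trans_eq ?_
        simp only [abs_mul, M]
    _ ≤ ∑ e ∈ p.support, a * M e := by
        refine Finset.sum_le_sum fun e he => mul_le_mul_of_nonneg_right ?_ (abs_nonneg _)
        exact (Finset.single_le_sum (f := fun e => |p.coeff e|)
          (fun _ _ => abs_nonneg _) he).trans ha
    _ = a * ∑ j ∈ Finset.Icc 1 k, ∑ e ∈ p.support with ∑ i, e i = j, M e := by
        rw [← Finset.mul_sum, Finset.sum_fiberwise_of_maps_to hdeg]
    _ ≤ a * ∑ j ∈ Finset.Icc 1 k, labelMomentDiv j D D' := by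
        refine mul_le_mul_of_nonneg_left (Finset.sum_le_sum fun j _ => ?_) ha0
        refine le_trans ?_ (sum_abs_labelDiff_le_labelMomentDiv j D D' c)
        rw [← Finset.sum_image (s := p.support.filter fun e => ∑ i, e i = j)
          (g := fun e : Fin n →₀ ℕ => (e : Fin n → ℕ)) (f := M)
          (fun _ _ _ _ h => DFunLike.coe_injective h)]
        refine Finset.sum_le_sum_of_subset_of_nonneg (fun e he => ?_) fun _ _ _ => abs_nonneg _
        obtain ⟨e', he', rfl⟩ := Finset.mem_image.1 he
        rw [Finset.mem_piAntidiag]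
        exact ⟨(Finset.mem_filter.1 he').2, fun _ _ => Finset.mem_univ _⟩

/-- For a fixed function `u` vanishing at the origin, the label-wise moment divergences up to some
order control the integrals of `u`, uniformly over all domains dominated by `ρ`. -/
lemma eventually_abs_labelDiff_le [CompactSpace X] (ρ : Measure X) [IsFiniteMeasure ρ] {u : X → ℝ}
    (hu : Integrable u ρ) (hu0 : ∀ x : X, (x : Fin n → ℝ) = 0 → u x = 0) {η : ℝ} (hη : 0 < η) :
    ∀ᶠ r : ℕ × ℝ in Filter.atTop, ∀ D D' : LabeledDomain X, D.μ + D'.μ ≤ ρ → ∀ c,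
      |D.labelDiff D' c u| ≤ η + r.2 * ∑ j ∈ Finset.Icc 1 r.1, labelMomentDiv j D D' := by
  obtain ⟨p, hp, hup⟩ := exists_constantCoeff_eq_zero_integral_abs_sub_le ρ hu hu0 hη
  filter_upwards [Filter.eventually_ge_atTop (p.totalDegree, ∑ e ∈ p.support, |p.coeff e|)]
    with r hr D D' hρ c
  have h1 := abs_labelDiff_eval_le D D' c hp hr.1 hr.2
  have h2 := D.abs_labelDiff_sub_le hρ c hu
    ((continuous_eval_coe p).integrable_of_compactSpace (ρ := ρ))
  have h3 := abs_sub_abs_le_abs_sub (D.labelDiff D' c u)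
    (D.labelDiff D' c fun x => MvPolynomial.eval (x : Fin n → ℝ) p)
  linarith

/-- The points other than the origin on which `h` does not predict the label `c`. -/
def missedAwayFromZero (h : X → Bool) (c : Bool) : Set X := {x | (x : Fin n → ℝ) ≠ 0 ∧ h x ≠ c}

lemma measurableSet_missedAwayFromZero {h : X → Bool} (hh : Measurable h) (c : Bool) :
    MeasurableSet (missedAwayFromZero h c) :=
  measurableSet_coe_ne_zero.inter (hh (measurableSet_singleton c)).compl

lemma integral_abs_indicator_missedAwayFromZero_sub_le (ρ : Measure X) [IsFiniteMeasure ρ]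
    {h f : X → Bool} (hh : Measurable h) (hf : Measurable f) (c : Bool) :
    ∫ x, |(missedAwayFromZero h c).indicator (1 : X → ℝ) x -
      (missedAwayFromZero f c).indicator 1 x| ∂ρ ≤ ρ.real {x | h x ≠ f x} := by
  have hi : ∀ {g : X → Bool}, Measurable g →
      Integrable ((missedAwayFromZero g c).indicator (1 : X → ℝ)) ρ := fun hg =>
    (integrable_const (1 : ℝ)).indicator (measurableSet_missedAwayFromZero hg c)
  rw [← integral_indicator_one (measurableSet_ne_label hf hh)]
  refine integral_mono ((hi hh).sub (hi hf)).abs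
    ((integrable_const (1 : ℝ)).indicator (measurableSet_ne_label hf hh)) fun x => ?_
  by_cases hx : h x = f x
  · simp [Set.indicator_apply, missedAwayFromZero, hx]
  · have hx' : x ∈ {x | h x ≠ f x} := hx
    simp only [Set.indicator_of_mem hx']
    by_cases h1 : x ∈ missedAwayFromZero h c <;> by_cases h2 : x ∈ missedAwayFromZero f c <;>
      simp [h1, h2]

/-- Uniform version of `eventually_abs_labelDiff_le` over a class of finite VC dimension. -/
lemma eventually_forall_abs_labelDiff_missed_le [CompactSpace X] (ρ : Measure X)
    [IsFiniteMeasure ρ] {H : Set (X → Bool)} (hH : ∀ h ∈ H, Measurable h) {d : ℕ}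
    (hd : classVCDim H ≤ d) {η : ℝ} (hη : 0 < η) :
    ∀ᶠ r : ℕ × ℝ in Filter.atTop, ∀ h ∈ H, ∀ D D' : LabeledDomain X, D.μ + D'.μ ≤ ρ → ∀ c,
      |D.labelDiff D' c ((missedAwayFromZero h c).indicator 1)| ≤
        2 * η + r.2 * ∑ j ∈ Finset.Icc 1 r.1, labelMomentDiv j D D' := by
  have hi : ∀ c, ∀ h ∈ H, Integrable ((missedAwayFromZero h c).indicator (1 : X → ℝ)) ρ :=
    fun c h hh => (integrable_const (1 : ℝ)).indicator
      (measurableSet_missedAwayFromZero (hH h hh) c)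
  obtain ⟨F, hF, hnet⟩ := exists_finset_net ρ hH hd hη
  -- The bounds hold for all large orders and constants, so the finitely many bounds for the net
  -- hold simultaneously.
  have hev : ∀ᶠ r : ℕ × ℝ in Filter.atTop, ∀ f ∈ F, ∀ b, ∀ D D' : LabeledDomain X,
      D.μ + D'.μ ≤ ρ → ∀ c, |D.labelDiff D' c ((missedAwayFromZero f b).indicator 1)| ≤
        η + r.2 * ∑ j ∈ Finset.Icc 1 r.1, labelMomentDiv j D D' := by
    rw [Filter.eventually_all_finset]
    intro f hf
    rw [Filter.eventually_all]
    exact fun b => eventually_abs_labelDiff_le ρ (hi b f (hF f hf))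
      (fun x hx => by simp [missedAwayFromZero, hx]) hη
  filter_upwards [hev] with r hr h hh D D' hρ c
  obtain ⟨f, hf, hhf⟩ := hnet h hh
  have h1 := hr f hf c D D' hρ c
  have h2 := (D.abs_labelDiff_sub_le hρ c (hi c h hh) (hi c f (hF f hf))).trans
    (integral_abs_indicator_missedAwayFromZero_sub_le ρ (hH h hh) (hH f (hF f hf)) c)
  have h3 := abs_sub_abs_le_abs_sub (D.labelDiff D' c ((missedAwayFromZero h c).indicator 1))
    (D.labelDiff D' c ((missedAwayFromZero f c).indicator 1))
  linarith

end Moments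

/-! ### The joint error and the atom at the origin -/

section JointError

variable {𝒳 : Type*} [MeasurableSpace 𝒳]

lemma jointError_nonneg (H : Set (𝒳 → Bool)) (D D' : LabeledDomain 𝒳) :
    0 ≤ jointError H D D' :=
  Real.iInf_nonneg fun _ => add_nonneg measureReal_nonneg measureReal_nonneg

/-- If the labels of two domains differ at a point, every hypothesis errs there on one of them. -/
lemma min_measureReal_singleton_le_jointError {H : Set (𝒳 → Bool)} (hne : H.Nonempty)
    (D D' : LabeledDomain 𝒳) {x : 𝒳} (hx : D.label x ≠ D'.label x) :
    min (D.μ.real {x}) (D'.μ.real {x}) ≤ jointError H D D' := by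
  have : Nonempty H := hne.to_subtype
  refine le_ciInf fun h => ?_
  have key : ∀ E : LabeledDomain 𝒳, (h : 𝒳 → Bool) x ≠ E.label x → E.μ.real {x} ≤ E.error h :=
    fun E hE => measureReal_mono (by simpa using hE)
  have hpos : ∀ E : LabeledDomain 𝒳, 0 ≤ E.error h := fun E => measureReal_nonneg
  by_cases h1 : (h : 𝒳 → Bool) x = D.label x
  · have := key D' (by rw [h1]; exact hx)
    exact (min_le_right _ _).trans (by linarith [hpos D])
  · have := key D h1
    have hpos' := hpos D'
    exact (min_le_left _ _).trans (by linarith)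

/-- The errors of a hypothesis on a set with at most one point. -/
lemma abs_measureReal_ne_inter_sub_le {H : Set (𝒳 → Bool)} (hne : H.Nonempty)
    (D D' : LabeledDomain 𝒳) {Z : Set 𝒳} (hZ : Z.Subsingleton) (h : 𝒳 → Bool) :
    |D.μ.real ({x | h x ≠ D.label x} ∩ Z) - D'.μ.real ({x | h x ≠ D'.label x} ∩ Z)| ≤
      jointError H D D' + |D.μ.real Z - D'.μ.real Z| := by
  have hJ := jointError_nonneg H D D'
  rcases hZ.eq_empty_or_singleton with rfl | ⟨x, rfl⟩
  · simpa using hJ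
  have key : ∀ E : LabeledDomain 𝒳, E.μ.real ({y | h y ≠ E.label y} ∩ {x}) =
      if h x ≠ E.label x then E.μ.real {x} else 0 := by
    intro E
    split_ifs with hx
    · rw [Set.inter_eq_right.2 (by simpa using hx)]
    · have : {y | h y ≠ E.label y} ∩ {x} = ∅ := by
        ext y
        simp only [Set.mem_inter_iff, Set.mem_ofPred_eq, Set.mem_singleton_iff,
          Set.mem_empty_iff_false, iff_false]
        rintro ⟨h1, rfl⟩
        exact hx h1
      rw [this, measureReal_empty]
  rw [key, key]
  have h1 : 0 ≤ D.μ.real {x} := measureReal_nonneg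
  have h2 : 0 ≤ D'.μ.real {x} := measureReal_nonneg
  have h3 := le_abs_self (D.μ.real {x} - D'.μ.real {x})
  have h4 := neg_abs_le (D.μ.real {x} - D'.μ.real {x})
  by_cases hx : D.label x = D'.label x
  · rw [hx]
    split_ifs
    · linarith
    · simp only [sub_self, abs_zero]; positivity
  · have hmin := min_measureReal_singleton_le_jointError hne D D' hx
    -- The smaller mass is at most the joint error, and the larger exceeds it by the difference of
    -- masses.
    have hbd : D.μ.real {x} ≤ jointError H D D' + |D.μ.real {x} - D'.μ.real {x}| ∧
        D'.μ.real {x} ≤ jointError H D D' + |D.μ.real {x} - D'.μ.real {x}| := by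
      rcases min_cases (D.μ.real {x}) (D'.μ.real {x}) with ⟨he, hle⟩ | ⟨he, hle⟩ <;>
        rw [he] at hmin <;> constructor <;> linarith
    split_ifs <;> rw [abs_le] <;> constructor <;> linarith [hbd.1, hbd.2]

end JointError

/-- **Comparison of errors.** The errors of the members of a class of finite VC dimension on two
domains differ by at most the best joint error, up to `ε` and a multiple of finitely many label-wise
moment divergences. The order and the multiple depend only on the class, on `ε` and on a measure
that dominates both data distributions. -/
theorem exists_abs_error_sub_error_le {n : ℕ} {X : Set (Fin n → ℝ)} [CompactSpace X]
    (ρ : Measure X) [IsFiniteMeasure ρ] {H : Set (X → Bool)} (hH : ∀ h ∈ H, Measurable h) {d : ℕ}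
    (hd : classVCDim H ≤ d) {ε : ℝ} (hε : 0 < ε) :
    ∃ (k : ℕ) (a : ℝ), ∀ D D' : LabeledDomain X, D.μ + D'.μ ≤ ρ → ∀ h ∈ H,
      |D.error h - D'.error h| ≤ jointError H D D' + ε +
        a * ∑ j ∈ Finset.Icc 1 k, labelMomentDiv j D D' := by
  -- Each of the two labels costs 2(ε/6) + `B` away from the origin and ε/6 + `B` at it: in total ε
  -- + 4`B`, whence the constant `4 * a`.
  have hη : 0 < ε / 6 := by positivity
  set E : Set X := {x | (x : Fin n → ℝ) ≠ 0}
  have hE : MeasurableSet E := measurableSet_coe_ne_zero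
  obtain ⟨⟨k, a⟩, h1, h2⟩ := ((eventually_forall_abs_labelDiff_missed_le ρ hH hd hη).and
    (eventually_abs_labelDiff_le ρ ((integrable_const (1 : ℝ)).indicator hE)
      (fun x hx => by simp [E, hx]) hη)).exists
  refine ⟨k, 4 * a, fun D D' hρ h hh => ?_⟩
  set B := a * ∑ j ∈ Finset.Icc 1 k, labelMomentDiv j D D'
  have hm := hH h hh
  have hsplit : ∀ G : LabeledDomain X, G.error h =
      G.μ.real ({x | h x ≠ G.label x} ∩ Eᶜ) +
        G.μ.real {x | x ∈ missedAwayFromZero h (G.label x)} := by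
    intro G
    rw [LabeledDomain.error, ← measureReal_inter_add_sdiff hE.compl]
    congr 2
    ext x
    simp [missedAwayFromZero, E, and_comm]
  have hone : ∀ G : LabeledDomain X, G.μ.real Eᶜ = 1 - G.μ.real {x | x ∈ E} := fun G =>
    probReal_compl_eq_one_sub hE
  have e1 := D.sum_labelDiff_indicator D' (measurableSet_missedAwayFromZero hm)
  have e2 := D.sum_labelDiff_indicator D' (E := fun _ => E) fun _ => hE
  rw [Fintype.sum_bool] at e1 e2
  have hsub : (Eᶜ : Set X).Subsingleton := fun x hx y hy => by
    have hx0 : (x : Fin n → ℝ) = 0 := not_not.1 hx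
    have hy0 : (y : Fin n → ℝ) = 0 := not_not.1 hy
    exact Subtype.ext (hx0.trans hy0.symm)
  have hz := abs_measureReal_ne_inter_sub_le ⟨h, hh⟩ D D' hsub h
  rw [hone D, hone D'] at hz
  have b1 : ∀ c, |D.labelDiff D' c ((missedAwayFromZero h c).indicator 1)| ≤ 2 * (ε / 6) + B :=
    h1 h hh D D' hρ
  have b2 : ∀ c, |D.labelDiff D' c (E.indicator 1)| ≤ ε / 6 + B := h2 D D' hρ
  -- The total masses are 1, so the masses at the origin differ exactly as those of `E` do, and the
  -- indicator of `E` vanishes at the origin.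
  have hz' : |1 - D.μ.real {x | x ∈ E} - (1 - D'.μ.real {x | x ∈ E})| ≤ 2 * (ε / 6 + B) := by
    have : 1 - D.μ.real {x | x ∈ E} - (1 - D'.μ.real {x | x ∈ E}) =
      -(D.labelDiff D' true (E.indicator 1) + D.labelDiff D' false (E.indicator 1)) := by
      rw [e2]; ring
    rw [this, abs_neg]
    exact (abs_add_le _ _).trans (by linarith [b2 true, b2 false])
  rw [hsplit D, hsplit D', add_sub_add_comm, ← e1]
  refine (abs_add_le _ _).trans ?_
  have := abs_add_le (D.labelDiff D' true ((missedAwayFromZero h true).indicator 1))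
    (D.labelDiff D' false ((missedAwayFromZero h false).indicator 1))
  have hB : 4 * a * ∑ j ∈ Finset.Icc 1 k, labelMomentDiv j D D' = 4 * B := by
    simp only [B]; ring
  rw [hB]
  linarith [b1 true, b1 false]

/-! ### Learning from several sources -/

section Sources

variable {𝒳 : Type*} [MeasurableSpace 𝒳] {N : ℕ}

/-- The weight of a sample point in the `α`-weighted empirical error. -/
noncomputable def sampleWeight (α : Fin N → ℝ) (nS : Fin N → ℕ)
    (q : (i : Fin N) × Fin (nS i)) : ℝ :=
  α q.1 / nS q.1

lemma weightedLoss_sampleWeight (S : Fin N → LabeledDomain 𝒳) (nS : Fin N → ℕ) (α : Fin N → ℝ)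
    (s : SourceSample 𝒳 nS) (h : 𝒳 → Bool) :
    weightedLoss (fun q : (i : Fin N) × Fin (nS i) => (S q.1).label) (sampleWeight α nS) s h =
      weightedEmpError S nS α s h := by
  rw [weightedLoss, Fintype.sum_sigma, weightedEmpError]
  refine Finset.sum_congr rfl fun i _ => ?_
  rw [empError, ← mul_assoc, Finset.mul_sum]
  refine Finset.sum_congr rfl fun j _ => ?_
  rw [sampleWeight, zeroOneLoss, mul_one_div]

lemma weightedRisk_sampleWeight (S : Fin N → LabeledDomain 𝒳) {nS : Fin N → ℕ}
    (hnS : ∀ i, 0 < nS i) (α : Fin N → ℝ) (h : 𝒳 → Bool) :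
    weightedRisk (fun q : (i : Fin N) × Fin (nS i) => (S q.1).μ) (fun q => (S q.1).label)
      (sampleWeight α nS) h = ∑ i, α i * (S i).error h := by
  rw [weightedRisk, Fintype.sum_sigma]
  refine Finset.sum_congr rfl fun i _ => ?_
  have : (nS i : ℝ) ≠ 0 := by exact_mod_cast (hnS i).ne'
  simp only [sampleWeight, Finset.sum_const, Finset.card_univ, Fintype.card_fin, nsmul_eq_mul,
    LabeledDomain.error]
  field_simp

lemma sum_sampleWeight_sq {nS : Fin N → ℕ} (hnS : ∀ i, 0 < nS i) (α : Fin N → ℝ) :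
    ∑ q, sampleWeight α nS q ^ 2 = ∑ i, α i ^ 2 / nS i := by
  rw [Fintype.sum_sigma]
  refine Finset.sum_congr rfl fun i _ => ?_
  have : (nS i : ℝ) ≠ 0 := by exact_mod_cast (hnS i).ne'
  simp only [sampleWeight, Finset.sum_const, Finset.card_univ, Fintype.card_fin, nsmul_eq_mul]
  field_simp

lemma sum_sq_div_pos {nS : Fin N → ℕ} (hnS : ∀ i, 0 < nS i) {α : Fin N → ℝ}
    (hα1 : ∑ i, α i = 1) : 0 < ∑ i, α i ^ 2 / nS i := by
  obtain ⟨i, -, hi⟩ : ∃ i ∈ Finset.univ, α i ≠ 0 :=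
    Finset.exists_ne_zero_of_sum_ne_zero (by rw [hα1]; exact one_ne_zero)
  refine Finset.sum_pos' (fun i _ => by positivity) ⟨i, Finset.mem_univ _, ?_⟩
  have : (0 : ℝ) < nS i := by exact_mod_cast hnS i
  positivity

lemma complexity_nonneg {d m : ℕ} (hdm : d ≤ 2 * m) :
    0 ≤ (d : ℝ) * (Real.log (2 * m / d) + 1) := by
  rcases Nat.eq_zero_or_pos d with rfl | hd
  · simp
  have hd' : (0 : ℝ) < d := by exact_mod_cast hd
  have h1 : (1 : ℝ) ≤ 2 * m / d := by rw [one_le_div hd']; exact_mod_cast hdm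
  have := Real.log_nonneg h1
  positivity

lemma sq_half_deviationTerm {d m : ℕ} (hdm : d ≤ 2 * m) (hm : 0 < m) {nS : Fin N → ℕ}
    {α β : Fin N → ℝ} (hβ : ∀ i, β i = (nS i : ℝ) / m) {δ : ℝ} (hδ : 0 < δ) (hδ1 : δ < 1) :
    (deviationTerm d α β m δ / 2) ^ 2 = 8 * (∑ i, α i ^ 2 / nS i) *
      (d * (Real.log (2 * m / d) + 1) + Real.log (4 / δ)) := by
  have hm' : (0 : ℝ) < m := by exact_mod_cast hm
  have hA : ∑ i, α i ^ 2 / β i = m * ∑ i, α i ^ 2 / nS i := by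
    rw [Finset.mul_sum]
    refine Finset.sum_congr rfl fun i _ => ?_
    rw [hβ, div_div_eq_mul_div]
    ring
  have hlog : 0 ≤ Real.log (4 / δ) := Real.log_nonneg (by rw [one_le_div hδ]; linarith)
  have hL := complexity_nonneg hdm
  have hW : 0 ≤ ∑ i, α i ^ 2 / (nS i : ℝ) := Finset.sum_nonneg fun i _ => by positivity
  have hin : (∑ i, α i ^ 2 / β i) *
      ((2 * d * (Real.log (2 * m / d) + 1) + 2 * Real.log (4 / δ)) / m) =
      2 * (∑ i, α i ^ 2 / nS i) * (d * (Real.log (2 * m / d) + 1) + Real.log (4 / δ)) := by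
    rw [hA]; field_simp
  rw [deviationTerm, hin, div_pow, mul_pow, Real.sq_sqrt (by positivity)]
  ring

/-- With probability at least `1 - δ`, the weighted empirical errors of all hypotheses are not much
smaller than their expectations, and that of `h₀` is not much larger. -/
theorem exists_measurableSet_deviation_le (S : Fin N → LabeledDomain 𝒳) {H : Set (𝒳 → Bool)}
    (hH : IsMeasurableClass H) {d : ℕ} (hd : classVCDim H ≤ d) {α : Fin N → ℝ}
    (hα1 : ∑ i, α i = 1) {nS : Fin N → ℕ} (hnS : ∀ i, 0 < nS i) {m : ℕ} (hm : m = ∑ i, nS i)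
    (hdm : d ≤ 2 * m) {β : Fin N → ℝ} (hβ : ∀ i, β i = (nS i : ℝ) / m) {h₀ : 𝒳 → Bool}
    (hh₀ : Measurable h₀) {δ : ℝ} (hδ : 0 < δ) (hδ1 : δ < 1) :
    ∃ G : Set (SourceSample 𝒳 nS), MeasurableSet G ∧ ENNReal.ofReal (1 - δ) ≤ sampleLaw S nS G ∧
      ∀ s ∈ G,
        (∀ h ∈ H, ∑ i, α i * (S i).error h ≤
          weightedEmpError S nS α s h + deviationTerm d α β m δ / 2) ∧
        weightedEmpError S nS α s h₀ ≤
          ∑ i, α i * (S i).error h₀ + deviationTerm d α β m δ / 2 := by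
  have hmpos : 0 < m := by
    rw [hm]
    have : N ≠ 0 := by rintro rfl; simp at hα1
    exact Finset.sum_pos (fun i _ => hnS i) ⟨⟨0, Nat.pos_of_ne_zero this⟩, Finset.mem_univ _⟩
  set w := sampleWeight α nS
  set μ := fun q : (i : Fin N) × Fin (nS i) => (S q.1).μ
  set l := fun q : (i : Fin N) × Fin (nS i) => (S q.1).label
  set t := deviationTerm d α β m δ / 2
  set L := (d : ℝ) * (Real.log (2 * m / d) + 1)
  have hL : 0 ≤ L := complexity_nonneg hdm
  have hl : ∀ q, Measurable (l q) := fun q => (S q.1).measurable_label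
  have ht : 0 ≤ t := by simp only [t, deviationTerm]; positivity
  have hw : 0 < ∑ q, w q ^ 2 := by rw [sum_sampleWeight_sq hnS]; exact sum_sq_div_pos hnS hα1
  set W := ∑ q, w q ^ 2 with hWdef
  have ht2 : t ^ 2 = 8 * W * (L + Real.log (4 / δ)) := by
    rw [hWdef, sum_sampleWeight_sq hnS]
    exact sq_half_deviationTerm hdm hmpos hβ hδ hδ1
  -- Since e < 4 < 4/δ; this gives t² ≥ 8`W`, more than symmetrization asks for.
  have hlog : 1 ≤ Real.log (4 / δ) := by
    rw [Real.le_log_iff_exp_le (by positivity), le_div_iff₀ hδ]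
    nlinarith [Real.exp_one_lt_d9, Real.exp_pos 1]
  have hexp : Real.exp (-Real.log (4 / δ)) = δ / 4 := by
    rw [Real.exp_neg, Real.exp_log (by positivity), inv_div]
  set K := ∑ k ∈ Finset.range (d + 1), (2 * m).choose k
  have hcard : Fintype.card ((i : Fin N) × Fin (nS i)) = m := by simp [hm]
  have hK : ∀ x : ((i : Fin N) × Fin (nS i)) ⊕ ((i : Fin N) × Fin (nS i)) → 𝒳,
      (traceFamily H x).card ≤ K := fun x => by
    have := card_traceFamily_le hd x
    rwa [Fintype.card_sum, hcard, ← two_mul] at this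
  have hKL : (K : ℝ) ≤ Real.exp L := by
    have := sum_range_choose_le_exp hdm
    push_cast at this ⊢
    simpa [K, L] using this
  set P := Measure.pi μ
  set B₁ := {s | ∃ h ∈ H, t < weightedRisk μ l w h - weightedLoss l w s h}
  set B₂ := {s | t ≤ weightedLoss l w s h₀ - weightedRisk μ l w h₀}
  have hB₁ : P B₁ ≤ ENNReal.ofReal (δ / 2) := by
    refine (measure_exists_weightedRisk_sub_weightedLoss_gt_le hH μ hK hl w hw ht ?_).trans
      (ENNReal.ofReal_le_ofReal ?_)
    · rw [ht2]
      nlinarith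
    -- The factor e^(-`L`) cancels the growth function `K`, leaving 2(δ/4).
    · have e : -t ^ 2 / (8 * W) = -L + -Real.log (4 / δ) := by
        rw [ht2]; field_simp; ring
      rw [← hWdef, e, Real.exp_add, hexp]
      have : (K : ℝ) * Real.exp (-L) ≤ 1 := by
        rw [Real.exp_neg, ← div_eq_mul_inv, div_le_one (Real.exp_pos _)]
        exact hKL
      nlinarith
  have hB₂ : P B₂ ≤ ENNReal.ofReal (δ / 2) := by
    rw [← ofReal_measureReal]
    refine ENNReal.ofReal_le_ofReal
      ((measureReal_weightedLoss_sub_weightedRisk_ge_le μ hl w hh₀ ht).trans ?_)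
    have e : -(2 * t ^ 2) / W ≤ -Real.log (4 / δ) := by
      rw [ht2, div_le_iff₀ hw]
      nlinarith
    calc _ ≤ Real.exp (-Real.log (4 / δ)) := Real.exp_le_exp.2 e
      _ ≤ δ / 2 := by rw [hexp]; linarith
  refine ⟨(toMeasurable P (B₁ ∪ B₂))ᶜ, (measurableSet_toMeasurable _ _).compl, ?_, ?_⟩
  · change _ ≤ P _
    rw [prob_compl_eq_one_sub (measurableSet_toMeasurable _ _), measure_toMeasurable,
      ENNReal.ofReal_sub _ hδ.le, ENNReal.ofReal_one]
    refine tsub_le_tsub_left ((measure_union_le _ _).trans ((add_le_add hB₁ hB₂).trans_eq ?_)) _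
    rw [← ENNReal.ofReal_add (by positivity) (by positivity), add_halves]
  · intro s hs
    have hs' : s ∉ B₁ ∪ B₂ := fun h => hs (subset_toMeasurable _ _ h)
    constructor
    · intro h hh
      have h1 : ¬ t < weightedRisk μ l w h - weightedLoss l w s h := fun h2 =>
        hs' (Or.inl ⟨h, hh, h2⟩)
      rw [weightedRisk_sampleWeight S hnS, weightedLoss_sampleWeight] at h1
      linarith
    · have h1 : ¬ t ≤ weightedLoss l w s h₀ - weightedRisk μ l w h₀ := fun h2 =>
        hs' (Or.inr h2)
      rw [weightedRisk_sampleWeight S hnS, weightedLoss_sampleWeight] at h1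
      linarith

end Sources

theorem theorem1 {n : ℕ} {X : Set (Fin n → ℝ)} (hX : IsCompact X)
    {N : ℕ} (S : Fin N → LabeledDomain X) (T : LabeledDomain X)
    (H : Set (X → Bool)) (hH : IsMeasurableClass H) (d : ℕ) (hd : classVCDim H = d)
    (α : Fin N → ℝ) (hα : ∀ i, 0 ≤ α i) (hα1 : ∑ i, α i = 1)
    (nS : Fin N → ℕ) (hnS : ∀ i, 0 < nS i)
    (m : ℕ) (hm : m = ∑ i, nS i) (hdm : d ≤ 2 * m)
    (β : Fin N → ℝ) (hβ : ∀ i, β i = (nS i : ℝ) / m)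
    (hT : X → Bool) (hTmem : hT ∈ H) (hTmin : ∀ h ∈ H, T.error hT ≤ T.error h) :
    ∀ δ : ℝ, 0 < δ → δ < 1 → ∀ ε : ℝ, 0 < ε →
      ∃ (nε : Fin N → ℕ) (a : Fin N → ℝ),
        ∃ G : Set (SourceSample X nS), MeasurableSet G ∧
          ENNReal.ofReal (1 - δ) ≤ sampleLaw S nS G ∧
          ∀ s ∈ G, ∀ hhat : X → Bool, IsEmpMinimizer S nS α H s hhat →
            T.error hhat ≤ T.error hT + deviationTerm d α β m δ + ε +
              ∑ i, α i * (2 * jointError H (S i) T +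
                a i * ∑ k ∈ Finset.Icc 1 (nε i), labelMomentDiv k (S i) T) := by
  intro δ hδ hδ1 ε hε
  have : CompactSpace X := isCompact_iff_compactSpace.1 hX
  choose nε a hcmp using fun i => exists_abs_error_sub_error_le ((S i).μ + T.μ) hH.measurable
    hd.le (half_pos hε)
  obtain ⟨G, hG, hGP, hdev⟩ := exists_measurableSet_deviation_le S hH hd.le hα1 hnS hm hdm hβ
    (hH.measurable hT hTmem) hδ hδ1
  -- The comparison is used for both `hhat` and `hT`, which doubles `a i` and the joint error and
  -- turns ε/2 into ε.
  refine ⟨nε, fun i => 2 * a i, G, hG, hGP, fun s hs hhat hmin => ?_⟩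
  obtain ⟨hdev₁, hdev₂⟩ := hdev s hs
  let b : Fin N → ℝ := fun i => jointError H (S i) T + ε / 2 +
    a i * ∑ k ∈ Finset.Icc 1 (nε i), labelMomentDiv k (S i) T
  have hb : ∀ i, ∀ h ∈ H, |(S i).error h - T.error h| ≤ b i := fun i => hcmp i (S i) T le_rfl
  have hconst : ∀ r : ℝ, ∑ i, α i * r = r := fun r => by rw [← Finset.sum_mul, hα1, one_mul]
  have h1 : T.error hhat ≤ ∑ i, α i * (S i).error hhat + ∑ i, α i * b i := by
    rw [← hconst (T.error hhat), ← Finset.sum_add_distrib]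
    refine Finset.sum_le_sum fun i _ => ?_
    rw [← mul_add]
    exact mul_le_mul_of_nonneg_left (by linarith [(abs_le.1 (hb i hhat hmin.1)).1]) (hα i)
  have h2 : ∑ i, α i * (S i).error hT ≤ T.error hT + ∑ i, α i * b i := by
    rw [← hconst (T.error hT), ← Finset.sum_add_distrib]
    refine Finset.sum_le_sum fun i _ => ?_
    rw [← mul_add]
    exact mul_le_mul_of_nonneg_left (by linarith [(abs_le.1 (hb i hT hTmem)).2]) (hα i)
  have h3 := hdev₁ hhat hmin.1
  have h4 := hmin.2 hT hTmem
  have h5 : ε + ∑ i, α i * (2 * jointError H (S i) T +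
      2 * a i * ∑ k ∈ Finset.Icc 1 (nε i), labelMomentDiv k (S i) T) = 2 * ∑ i, α i * b i := by
    rw [← hconst ε, ← Finset.sum_add_distrib, Finset.mul_sum]
    exact Finset.sum_congr rfl fun i _ => by simp only [b]; ring
  linarith
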